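/- Let $n \ge 0$ be an integer and let $\gamma_n$ be the standard Gaussian measure on $\mathbb{R}^n$. For $-1 < \rho < 1$ let $(X, Y)$ be a pair of jointly Gaussian random vectors in $\mathbb{R}^n$ such that $X$ and $Y$ each have law $\gamma_n$ and $\mathbb{E} X_i Y_j = \rho\,\delta_{ij}$ for all $i, j$; write $\mathbb{E}_\rho$ for the expectation with respect to their joint law. Let $\Phi(x) = \frac{1}{\sqrt{2\pi}}\int_{-\infty}^x e^{-s^2/2}\,ds$, and let $\Phi^{-1} : [0,1] \to [-\infty, \infty]$ be its inverse, with $\Phi^{-1}(0) = -\infty$ and $\Phi^{-1}(1) = \infty$. For $x, y \in [0,1]$ let $J(x, y; \rho) = \Pr\big(U \le \Phi^{-1}(x),\ V \le \Phi^{-1}(y)\big)$, where $(U, V)$ is a pair of jointly Gaussian real random variables, each standard Gaussian, with $\mathbb{E}\, UV = \rho$. Let $f, g : \mathbb{R}^n \to [0,1]$ be measurable. If $0 < \rho < 1$, then $$\mathbb{E}_\rho\, J(f(X), g(Y); \rho) \le J\Big(\int f\, d\gamma_n,\ \int g\, d\gamma_n;\ \rho\Big).$$ If $-1 < \rho < 0$,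 then $$\mathbb{E}_\rho\, J(f(X), g(Y); \rho) \ge J\Big(\int f\, d\gamma_n,\ \int g\, d\gamma_n;\ \rho\Big).$$ (In both cases $J(f(X), g(Y); \rho)$ is integrable.) -/

import Mathlib

open MeasureTheory ProbabilityTheory

noncomputable section

/-- The joint law `Pr_ρ` of a pair `(X, Y)` of `ρ`-correlated standard Gaussian vectors in a
finite-dimensional Euclidean space `E`: `Y = ρ X + √(1 - ρ²) Z`, where `X` and `Z` are independent
standard Gaussian vectors. For `|ρ| ≤ 1` this is the centred Gaussian law on `E × E` whose marginals
are standard Gaussian and for which, in orthonormal coordinates, `𝔼 Xᵢ Yⱼ = ρ δᵢⱼ`. -/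
def corrGaussian (E : Type*) [NormedAddCommGroup E] [InnerProductSpace ℝ E]
    [FiniteDimensional ℝ E] [MeasurableSpace E] [BorelSpace E] (ρ : ℝ) : Measure (E × E) :=
  ((stdGaussian E).prod (stdGaussian E)).map
    (fun p : E × E => (p.1, ρ • p.1 + Real.sqrt (1 - ρ ^ 2) • p.2))

/-- The distribution function `Φ` of the standard Gaussian measure on `ℝ`. -/
def stdNormalCDF (t : ℝ) : ℝ := cdf (gaussianReal 0 1) t

/-- The inverse `Φ⁻¹ : [0, 1] → [-∞, ∞]`, as the quantile function `inf {t ∈ ℝ | p ≤ Φ t}`. The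
infimum is taken in `[-∞, ∞]`, so that `Φ⁻¹ 0 = -∞` and `Φ⁻¹ 1 = ∞`. -/
def stdNormalQuantile (p : ℝ) : EReal :=
  sInf ((fun t : ℝ => (t : EReal)) '' {t : ℝ | p ≤ stdNormalCDF t})

/-- `J(x, y; ρ) = Pr_ρ (X₁ ≤ Φ⁻¹(x), Y₁ ≤ Φ⁻¹(y))`, where `(X₁, Y₁)` is a pair of `ρ`-correlated
standard Gaussian real random variables. -/
def borellJ (x y ρ : ℝ) : ℝ :=
  (corrGaussian ℝ ρ).real
    {p : ℝ × ℝ | (p.1 : EReal) ≤ stdNormalQuantile x ∧ (p.2 : EReal) ≤ stdNormalQuantile y}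

end

/-!
Write `J(x, y) = borellJ x y ρ`, let `X`, `Y` be `ρ`-correlated standard Gaussian vectors, and let
`K = J` for `ρ > 0` and `K = -J` for `ρ < 0`. The inequality `𝔼 K(f(X), g(Y)) ≤ K(𝔼 f(X), 𝔼 g(Y))`
rests on a pointwise property of `K`: its Hessian, with the off-diagonal entries multiplied by `ρ`,
is negative semidefinite on the open unit square. In the coordinates `x = Φ(s)`, `y = Φ(t)` the
corresponding quadratic form of `J` is `-ρ p(s, t) (a / φ(s) - b / φ(t))²`, where `p` is the joint
density of a `ρ`-correlated pair and `φ` the standard normal density (`exists_borellJ_taylor`).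

Run the heat flow in small time steps `δ`. If `f` and `g` are regular and take values in
`[ε, 1 - ε]`, then over one step their fluctuations around their means are `√δ ⟪∇f, Z⟫` and
`√δ ⟪∇g, W⟫` up to `O(δ)`, where `(Z, W)` is `ρ`-correlated. In the second-order expansion of `K`
the linear terms average to zero, and the quadratic terms average to
`δ (K_xx |∇f|² + 2 ρ K_xy ⟪∇f, ∇g⟫ + K_yy |∇g|²) / 2 ≤ 0`. Hence one step violates the inequality by
at most `O(δ^{3/2})` (`integral_increment_le`). The heat flow does not deteriorate the regularity of
`f` and `g` (`IsTame.heat`), so the errors of `1 / δ` steps add up to `O(δ^{1/2})`, which tends to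
zero (`integral_le_of_isTame`).

Finally `J` is `1`-Lipschitz in each variable on the whole square, because `Φ⁻¹(x)` and `Φ⁻¹(x')`
enclose Gaussian mass `|x - x'|` (`abs_borellJ_sub_le`). So both sides are continuous in `f` and `g`
for the `L¹` distance, and regular functions are dense (`exists_isTame_approx`).
-/

/-! ### Correlated Gaussian pairs -/

section CorrelatedGaussian

variable {E : Type*} [NormedAddCommGroup E] [InnerProductSpace ℝ E] [FiniteDimensional ℝ E]
  [MeasurableSpace E] [BorelSpace E] {ρ : ℝ}

open scoped InnerProductSpace

theorem measurable_correlate (ρ : ℝ) :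
    Measurable (fun p : E × E => (p.1, ρ • p.1 + Real.sqrt (1 - ρ ^ 2) • p.2)) := by
  fun_prop

instance isGaussian_corrGaussian : IsGaussian (corrGaussian E ρ) := by
  have : (fun p : E × E => (p.1, ρ • p.1 + Real.sqrt (1 - ρ ^ 2) • p.2)) =
      ⇑((ContinuousLinearMap.fst ℝ E E).prod (ρ • ContinuousLinearMap.fst ℝ E E +
        Real.sqrt (1 - ρ ^ 2) • ContinuousLinearMap.snd ℝ E E)) := by
    ext p <;> simp
  rw [corrGaussian, this]
  infer_instance

theorem map_fst_corrGaussian : (corrGaussian E ρ).map Prod.fst = stdGaussian E := by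
  rw [corrGaussian, Measure.map_map measurable_fst (measurable_correlate ρ)]
  change Measure.map Prod.fst _ = _
  simp

/-- A correlated pair is exchangeable: the reflection of `E × E` with axis at half the correlation
angle is a rotation followed by a sign change, so it preserves the product Gaussian measure. -/
theorem map_swap_corrGaussian (h₁ : -1 < ρ) (h₂ : ρ < 1) :
    (corrGaussian E ρ).map Prod.swap = corrGaussian E ρ := by
  set r := Real.sqrt (1 - ρ ^ 2) with hr
  have hr2 : r ^ 2 = 1 - ρ ^ 2 := Real.sq_sqrt (by nlinarith)
  have hrot := IsGaussian.map_rotation_eq_self (μ := stdGaussian E)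
    (by simp) (Real.arccos ρ)
  have hneg : ((stdGaussian E).prod (stdGaussian E)).map (Prod.map id (fun x => -x)) =
      (stdGaussian E).prod (stdGaussian E) := by
    rw [← Measure.map_prod_map _ _ measurable_id measurable_neg]
    congr 1
    · simp
    · exact stdGaussian_map (LinearIsometryEquiv.neg ℝ (E := E))
  have hrefl : ((stdGaussian E).prod (stdGaussian E)).map
      (fun p : E × E => (ρ • p.1 + r • p.2, r • p.1 - ρ • p.2)) =
      (stdGaussian E).prod (stdGaussian E) := by
    conv_rhs => rw [← hneg, ← hrot]
    rw [Measure.map_map (by fun_prop) (by fun_prop)]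
    congr 1
    ext p
    · simp [ContinuousLinearMap.rotation_apply, Real.cos_arccos h₁.le h₂.le, Real.sin_arccos, hr]
    · simp [ContinuousLinearMap.rotation_apply, Real.cos_arccos h₁.le h₂.le, Real.sin_arccos, hr]
      abel
  conv_rhs => rw [corrGaussian, ← hrefl]
  rw [corrGaussian, Measure.map_map measurable_swap (measurable_correlate ρ),
    Measure.map_map (measurable_correlate ρ) (by fun_prop)]
  congr 1
  ext p
  · simp [hr]
  · simp only [Function.comp_apply, Prod.swap_prod_mk, ← hr]
    rw [smul_add, smul_sub, smul_smul, smul_smul, smul_smul, smul_smul]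
    have : p.1 = (ρ * ρ + r * r) • p.1 := by
      rw [show ρ * ρ + r * r = 1 by nlinarith, one_smul]
    conv_lhs => rw [this]
    rw [add_smul, mul_comm ρ r]
    abel

theorem map_snd_corrGaussian (h₁ : -1 < ρ) (h₂ : ρ < 1) :
    (corrGaussian E ρ).map Prod.snd = stdGaussian E := by
  rw [← map_swap_corrGaussian h₁ h₂, Measure.map_map measurable_snd measurable_swap]
  exact map_fst_corrGaussian

theorem integral_fst_corrGaussian {f : E → ℝ} (hf : Measurable f) :
    ∫ p, f p.1 ∂(corrGaussian E ρ) = ∫ x, f x ∂(stdGaussian E) := by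
  rw [← map_fst_corrGaussian (ρ := ρ), integral_map (by fun_prop) hf.aestronglyMeasurable]

theorem integral_snd_corrGaussian (h₁ : -1 < ρ) (h₂ : ρ < 1) {f : E → ℝ} (hf : Measurable f) :
    ∫ p, f p.2 ∂(corrGaussian E ρ) = ∫ x, f x ∂(stdGaussian E) := by
  rw [← map_snd_corrGaussian h₁ h₂, integral_map (by fun_prop) hf.aestronglyMeasurable]

theorem integrable_fst_corrGaussian {f : E → ℝ} (hf : Integrable f (stdGaussian E)) :
    Integrable (fun p : E × E => f p.1) (corrGaussian E ρ) := by
  rw [← map_fst_corrGaussian (ρ := ρ)] at hf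
  exact hf.comp_measurable measurable_fst

theorem integrable_snd_corrGaussian (h₁ : -1 < ρ) (h₂ : ρ < 1) {f : E → ℝ}
    (hf : Integrable f (stdGaussian E)) :
    Integrable (fun p : E × E => f p.2) (corrGaussian E ρ) := by
  rw [← map_snd_corrGaussian h₁ h₂] at hf
  exact hf.comp_measurable measurable_snd

theorem integral_id_corrGaussian (h₁ : -1 < ρ) (h₂ : ρ < 1) :
    ∫ p, p ∂(corrGaussian E ρ) = 0 := by
  have hi : Integrable (fun p : E × E => p) (corrGaussian E ρ) := IsGaussian.integrable_id
  have hf := (ContinuousLinearMap.fst ℝ E E).integral_comp_comm hi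
  have hs := (ContinuousLinearMap.snd ℝ E E).integral_comp_comm hi
  have e1 : ∫ p : E × E, p.1 ∂(corrGaussian E ρ) = 0 := by
    rw [← integral_id_stdGaussian, ← map_fst_corrGaussian (E := E) (ρ := ρ),
      integral_map (by fun_prop) (by fun_prop)]
  have e2 : ∫ p : E × E, p.2 ∂(corrGaussian E ρ) = 0 := by
    rw [← integral_id_stdGaussian, ← map_snd_corrGaussian (E := E) h₁ h₂,
      integral_map (by fun_prop) (by fun_prop)]
  simp only [ContinuousLinearMap.coe_fst', e1] at hf
  simp only [ContinuousLinearMap.coe_snd', e2] at hs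
  exact Prod.ext hf.symm hs.symm

theorem integral_inner_mul_inner_stdGaussian (a b : E) :
    ∫ x, ⟪a, x⟫_ℝ * ⟪b, x⟫_ℝ ∂(stdGaussian E) = ⟪a, b⟫_ℝ := by
  have h := covarianceBilin_apply_eq_cov (μ := stdGaussian E) IsGaussian.memLp_two_id a b
  rw [covarianceBilin_stdGaussian, covariance] at h
  have h0 : ∀ c : E, ∫ x, ⟪c, x⟫_ℝ ∂(stdGaussian E) = 0 := fun c =>
    integral_strongDual_stdGaussian (innerSL ℝ c)
  rw [h0 a, h0 b] at h
  simpa using! h.symm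

theorem memLp_inner_stdGaussian (a : E) : MemLp (fun x => ⟪a, x⟫_ℝ) 2 (stdGaussian E) :=
  IsGaussian.memLp_dual (stdGaussian E) (innerSL ℝ a) 2 (by simp)

theorem integrable_inner_fst_mul_inner_snd_corrGaussian (h₁ : -1 < ρ) (h₂ : ρ < 1) (a b : E) :
    Integrable (fun p : E × E => ⟪a, p.1⟫_ℝ * ⟪b, p.2⟫_ℝ) (corrGaussian E ρ) := by
  have hA := memLp_inner_stdGaussian a
  have hB := memLp_inner_stdGaussian b
  rw [← map_fst_corrGaussian (ρ := ρ)] at hA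
  rw [← map_snd_corrGaussian h₁ h₂] at hB
  exact (hA.comp_of_map measurable_fst.aemeasurable).integrable_mul
    (hB.comp_of_map measurable_snd.aemeasurable)

theorem integral_inner_fst_mul_inner_snd_corrGaussian (a b : E) :
    ∫ p, ⟪a, p.1⟫_ℝ * ⟪b, p.2⟫_ℝ ∂(corrGaussian E ρ) = ρ * ⟪a, b⟫_ℝ := by
  rw [corrGaussian, integral_map (measurable_correlate ρ).aemeasurable
    (Continuous.aestronglyMeasurable (by fun_prop))]
  have hA := memLp_inner_stdGaussian a
  have hB := memLp_inner_stdGaussian b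
  have i1 : Integrable (fun p : E × E => ρ * (⟪a, p.1⟫_ℝ * ⟪b, p.1⟫_ℝ))
      ((stdGaussian E).prod (stdGaussian E)) :=
    (Integrable.comp_fst (hA.integrable_mul hB) _).const_mul ρ
  have i2 : Integrable (fun p : E × E => Real.sqrt (1 - ρ ^ 2) * (⟪a, p.1⟫_ℝ * ⟪b, p.2⟫_ℝ))
      ((stdGaussian E).prod (stdGaussian E)) :=
    ((hA.integrable (by simp)).mul_prod (hB.integrable (by simp))).const_mul _
  calc _ = ∫ p : E × E, (ρ * (⟪a, p.1⟫_ℝ * ⟪b, p.1⟫_ℝ) +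
        Real.sqrt (1 - ρ ^ 2) * (⟪a, p.1⟫_ℝ * ⟪b, p.2⟫_ℝ))
          ∂((stdGaussian E).prod (stdGaussian E)) := by
        congr 1
        ext p
        simp only [inner_add_right, inner_smul_right]
        ring
    _ = _ := by
        have h0 : ∫ x, ⟪b, x⟫_ℝ ∂(stdGaussian E) = 0 :=
          integral_strongDual_stdGaussian (innerSL ℝ b)
        rw [integral_add i1 i2, integral_const_mul, integral_const_mul,
          integral_prod_mul (fun x => ⟪a, x⟫_ℝ) (fun x => ⟪b, x⟫_ℝ), h0,
          integral_fun_fst (fun x => ⟪a, x⟫_ℝ * ⟪b, x⟫_ℝ), integral_inner_mul_inner_stdGaussian]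
        simp

end CorrelatedGaussian

/-! ### The heat flow of a centred Gaussian measure -/

section Heat

variable {V : Type*} [NormedAddCommGroup V] [NormedSpace ℝ V] [MeasurableSpace V]

/-- The heat flow driven by a measure `μ`: the average of `F` over `x + √s Z`, where `Z` has
law `μ`. -/
noncomputable def heat (μ : Measure V) (s : ℝ) (F : V → ℝ) (x : V) : ℝ :=
  ∫ z, F (x + Real.sqrt s • z) ∂μ

theorem measurable_heat [BorelSpace V] [SecondCountableTopology V] {μ : Measure V} [SFinite μ]
    {F : V → ℝ} (hF : Measurable F) (s : ℝ) :
    Measurable (heat μ s F) := by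
  have : StronglyMeasurable (Function.uncurry fun x z : V => F (x + Real.sqrt s • z)) :=
    Measurable.stronglyMeasurable (by unfold Function.uncurry; fun_prop)
  exact this.integral_prod_right.measurable

theorem integrable_comp_add_smul [BorelSpace V] {μ : Measure V} [IsFiniteMeasure μ] {F : V → ℝ}
    (hF : Measurable F) {C : ℝ} (hC : ∀ x, |F x| ≤ C) (x : V) (c : ℝ) :
    Integrable (fun z => F (x + c • z)) μ :=
  .of_bound (Measurable.aestronglyMeasurable (by fun_prop)) C (.of_forall fun _ => hC _)

theorem abs_heat_le {μ : Measure V} [IsProbabilityMeasure μ] {F : V → ℝ} {C : ℝ}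
    (hC : ∀ x, |F x| ≤ C) (s : ℝ) (x : V) : |heat μ s F x| ≤ C := by
  simpa [heat] using norm_integral_le_of_norm_le_const (μ := μ)
    (f := fun z => F (x + Real.sqrt s • z))
    (.of_forall fun _ => hC _)

/-- The semigroup property of the heat flow of a centred Gaussian measure; it expresses that the
product measure is invariant under rotations. -/
theorem heat_heat [BorelSpace V] [SecondCountableTopology V] [CompleteSpace V]
    {μ : Measure V} [IsGaussian μ] (hμ : ∫ x, x ∂μ = 0)
    {F : V → ℝ} (hF : Measurable F) {C : ℝ} (hC : ∀ x, |F x| ≤ C) {s t : ℝ} (hs : 0 ≤ s)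
    (ht : 0 < t) (x : V) : heat μ s (heat μ t F) x = heat μ (s + t) F x := by
  have hst : 0 < s + t := by positivity
  set c := Real.sqrt (s / (s + t)) with hc
  have hc1 : c ≤ 1 := Real.sqrt_le_one.2 (by rw [div_le_one hst]; linarith)
  have hc0 : 0 ≤ c := Real.sqrt_nonneg _
  have hd : Real.sqrt (1 - c ^ 2) = Real.sqrt (t / (s + t)) := by
    rw [hc, Real.sq_sqrt (by positivity)]
    congr 1
    field_simp
    ring
  have hrot := IsGaussian.map_rotation_eq_self (μ := μ) (by simpa using hμ) (Real.arccos c)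
  have hint : Integrable (fun p : V × V => F (x + Real.sqrt s • p.1 + Real.sqrt t • p.2))
      (μ.prod μ) :=
    .of_bound (Measurable.aestronglyMeasurable (by fun_prop)) C (.of_forall fun _ => hC _)
  calc heat μ s (heat μ t F) x
      = ∫ p : V × V, F (x + Real.sqrt s • p.1 + Real.sqrt t • p.2) ∂(μ.prod μ) :=
        (integral_prod _ hint).symm
    _ = ∫ p : V × V, F (x + Real.sqrt (s + t) • (ContinuousLinearMap.rotation (Real.arccos c) p).1)
          ∂(μ.prod μ) := by
        congr 1
        ext p
        rw [ContinuousLinearMap.rotation_apply, Real.cos_arccos (by linarith) hc1,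
          Real.sin_arccos, hd, smul_add, smul_smul, smul_smul, hc, ← Real.sqrt_mul hst.le,
          ← Real.sqrt_mul hst.le, mul_div_cancel₀ _ hst.ne', mul_div_cancel₀ _ hst.ne', add_assoc]
    _ = ∫ p : V × V, F (x + Real.sqrt (s + t) • p.1) ∂(μ.prod μ) := by
        conv_rhs => rw [← hrot]
        rw [integral_map (by fun_prop) (Measurable.aestronglyMeasurable (by fun_prop))]
    _ = heat μ (s + t) F x := by
        rw [integral_fun_fst (fun z => F (x + Real.sqrt (s + t) • z))]
        simp [heat]

end Heat

open Filter Topology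

/-! ### The standard normal distribution function and its inverse -/

theorem stdGaussian_real : stdGaussian ℝ = gaussianReal 0 1 := by
  apply Measure.ext_of_charFun
  ext t
  rw [charFun_stdGaussian, charFun_gaussianReal]
  congr 1
  simp only [Real.norm_eq_abs, ← Complex.ofReal_pow, sq_abs]
  simp
  ring

/-- The density of the standard Gaussian measure on the line. -/
noncomputable def stdNormalPDF (t : ℝ) : ℝ := gaussianPDFReal 0 1 t

theorem stdNormalPDF_eq (t : ℝ) :
    stdNormalPDF t = (Real.sqrt (2 * Real.pi))⁻¹ * Real.exp (-t ^ 2 / 2) := by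
  simp [stdNormalPDF, gaussianPDFReal]

theorem stdNormalPDF_pos (t : ℝ) : 0 < stdNormalPDF t := gaussianPDFReal_pos 0 1 t one_ne_zero

theorem contDiff_stdNormalPDF {n : WithTop ℕ∞} : ContDiff ℝ n stdNormalPDF := by
  have : stdNormalPDF = fun t => (Real.sqrt (2 * Real.pi))⁻¹ * Real.exp (-t ^ 2 / 2) :=
    funext stdNormalPDF_eq
  rw [this]
  fun_prop

theorem continuous_stdNormalPDF : Continuous stdNormalPDF :=
  (contDiff_stdNormalPDF (n := 0)).continuous

theorem hasDerivAt_integral_Iic {h : ℝ → ℝ} (hc : Continuous h) (hi : Integrable h) (t : ℝ) :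
    HasDerivAt (fun s => ∫ u in Set.Iic s, h u) (h t) t := by
  have e : (fun s => ∫ u in Set.Iic s, h u) =
      fun s => (∫ u in Set.Iic (0 : ℝ), h u) + ∫ u in (0 : ℝ)..s, h u := by
    ext s
    rw [← intervalIntegral.integral_Iic_sub_Iic hi.integrableOn hi.integrableOn]
    ring
  rw [e]
  exact (intervalIntegral.integral_hasDerivAt_right (hc.intervalIntegrable _ _)
    hc.stronglyMeasurable.stronglyMeasurableAtFilter hc.continuousAt).const_add _

theorem stdNormalCDF_eq_real_Iic (t : ℝ) :
    stdNormalCDF t = (stdGaussian ℝ).real (Set.Iic t) := by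
  rw [stdNormalCDF, cdf_eq_real, stdGaussian_real]

theorem stdNormalCDF_eq_integral (t : ℝ) :
    stdNormalCDF t = ∫ u in Set.Iic t, stdNormalPDF u := by
  rw [stdNormalCDF, cdf_eq_real, measureReal_def, gaussianReal_apply_eq_integral 0 one_ne_zero,
    ENNReal.toReal_ofReal (integral_nonneg fun u => (gaussianPDFReal_nonneg 0 1 u))]
  rfl

theorem hasDerivAt_stdNormalCDF (t : ℝ) : HasDerivAt stdNormalCDF (stdNormalPDF t) t := by
  rw [show stdNormalCDF = fun s => ∫ u in Set.Iic s, stdNormalPDF u from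
    funext stdNormalCDF_eq_integral]
  exact hasDerivAt_integral_Iic continuous_stdNormalPDF (integrable_gaussianPDFReal 0 1) t

theorem continuous_stdNormalCDF : Continuous stdNormalCDF :=
  continuous_iff_continuousAt.2 fun t => (hasDerivAt_stdNormalCDF t).continuousAt

theorem strictMono_stdNormalCDF : StrictMono stdNormalCDF :=
  strictMono_of_hasDerivAt_pos hasDerivAt_stdNormalCDF stdNormalPDF_pos

theorem stdNormalCDF_mem_Ioo (t : ℝ) : stdNormalCDF t ∈ Set.Ioo (0 : ℝ) 1 :=
  ⟨(cdf_nonneg _ _).trans_lt (strictMono_stdNormalCDF (sub_one_lt t)),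
    (strictMono_stdNormalCDF (lt_add_one t)).trans_le (cdf_le_one _ _)⟩

theorem exists_stdNormalCDF_eq {x : ℝ} (hx : x ∈ Set.Ioo (0 : ℝ) 1) :
    ∃ t, stdNormalCDF t = x :=
  mem_range_of_exists_le_of_exists_ge continuous_stdNormalCDF
    (((tendsto_cdf_atBot _).eventually (ge_mem_nhds hx.1)).exists)
    (((tendsto_cdf_atTop _).eventually (le_mem_nhds hx.2)).exists)

theorem stdNormalQuantile_stdNormalCDF (t : ℝ) :
    stdNormalQuantile (stdNormalCDF t) = (t : EReal) := by
  have : {s : ℝ | stdNormalCDF t ≤ stdNormalCDF s} = Set.Ici t := by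
    ext s
    simp [strictMono_stdNormalCDF.le_iff_le]
  rw [stdNormalQuantile, this]
  refine IsLeast.csInf_eq ⟨⟨t, Set.self_mem_Ici, rfl⟩, ?_⟩
  rintro _ ⟨s, hs, rfl⟩
  exact EReal.coe_le_coe_iff.2 hs

theorem stdNormalQuantile_of_nonpos {x : ℝ} (hx : x ≤ 0) : stdNormalQuantile x = ⊥ := by
  rw [stdNormalQuantile, sInf_eq_bot]
  intro b hb
  obtain ⟨t, ht1, ht2⟩ := EReal.lt_iff_exists_real_btwn.1 hb
  exact ⟨t, ⟨t, hx.trans (stdNormalCDF_mem_Ioo t).1.le, rfl⟩, ht2⟩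

theorem stdNormalQuantile_of_one_le {x : ℝ} (hx : 1 ≤ x) : stdNormalQuantile x = ⊤ := by
  have : {s : ℝ | x ≤ stdNormalCDF s} = ∅ := by
    ext s
    simpa using (stdNormalCDF_mem_Ioo s).2.trans_le hx
  simp [stdNormalQuantile, this]

theorem monotone_stdNormalQuantile : Monotone stdNormalQuantile := fun _ _ hxy =>
  sInf_le_sInf (Set.image_mono fun _ ht => hxy.trans ht)

/-- The defining property of the quantile; outside `[0, 1]` the quantile is infinite, whence the
truncation. -/
theorem real_le_stdNormalQuantile (x : ℝ) :
    (stdGaussian ℝ).real {u : ℝ | (u : EReal) ≤ stdNormalQuantile x} = max 0 (min x 1) := by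
  rcases le_or_gt x 0 with h0 | h0
  · have : max 0 (min x 1) = 0 := max_eq_left ((min_le_left _ _).trans h0)
    simp [stdNormalQuantile_of_nonpos h0, this]
  rcases le_or_gt 1 x with h1 | h1
  · have : max 0 (min x 1) = 1 := by simp [h1]
    simp [stdNormalQuantile_of_one_le h1, this]
  obtain ⟨t, rfl⟩ := exists_stdNormalCDF_eq ⟨h0, h1⟩
  rw [min_eq_left h1.le, max_eq_right h0.le, stdNormalQuantile_stdNormalCDF]
  simp only [EReal.coe_le_coe_iff]
  exact (stdNormalCDF_eq_real_Iic t).symm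

/-! ### Regularity of `borellJ` up to the boundary -/

theorem measurableSet_le_stdNormalQuantile (x : ℝ) :
    MeasurableSet {u : ℝ | (u : EReal) ≤ stdNormalQuantile x} :=
  measurableSet_le measurable_coe_real_ereal measurable_const

theorem borellJ_comm {ρ : ℝ} (h₁ : -1 < ρ) (h₂ : ρ < 1) (x y : ℝ) :
    borellJ x y ρ = borellJ y x ρ := by
  rw [borellJ, borellJ]
  conv_lhs => rw [← map_swap_corrGaussian h₁ h₂]
  rw [map_measureReal_apply measurable_swap
    (s := {p : ℝ × ℝ | (p.1 : EReal) ≤ stdNormalQuantile x ∧ (p.2 : EReal) ≤ stdNormalQuantile y})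
    (((measurableSet_le_stdNormalQuantile x).preimage measurable_fst).inter
      ((measurableSet_le_stdNormalQuantile y).preimage measurable_snd))]
  congr 1
  ext p
  simp [and_comm]

theorem borellJ_mono_left {x x' : ℝ} (h : x ≤ x') (y ρ : ℝ) : borellJ x y ρ ≤ borellJ x' y ρ :=
  measureReal_mono fun _ hp => ⟨hp.1.trans (monotone_stdNormalQuantile h), hp.2⟩

theorem borellJ_sub_le_left {x x' : ℝ} (h : x ≤ x') (y ρ : ℝ) :
    borellJ x' y ρ - borellJ x y ρ ≤ x' - x := by
  set A : ℝ → Set ℝ := fun x => {u : ℝ | (u : EReal) ≤ stdNormalQuantile x} with hA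
  have hAm : ∀ x, MeasurableSet (A x) := measurableSet_le_stdNormalQuantile
  have hsub : A x ⊆ A x' := fun u hu => le_trans hu (monotone_stdNormalQuantile h)
  calc borellJ x' y ρ - borellJ x y ρ
      ≤ (corrGaussian ℝ ρ).real (Prod.fst ⁻¹' (A x' \ A x)) := by
        rw [sub_le_iff_le_add', borellJ, borellJ]
        refine (measureReal_mono ?_).trans (measureReal_union_le _ _)
        rintro p ⟨h1, h2⟩
        by_cases hp : p.1 ∈ A x
        · exact Or.inl ⟨hp, h2⟩
        · exact Or.inr ⟨h1, hp⟩
    _ = (stdGaussian ℝ).real (A x' \ A x) := by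
        rw [← map_fst_corrGaussian (ρ := ρ),
          map_measureReal_apply measurable_fst ((hAm x').diff (hAm x))]
    _ = max 0 (min x' 1) - max 0 (min x 1) := by
        rw [measureReal_sdiff hsub (hAm x), real_le_stdNormalQuantile, real_le_stdNormalQuantile]
    _ ≤ x' - x := by
        rcases max_cases 0 (min x' 1) with h1 | h1 <;> rcases max_cases 0 (min x 1) with h2 | h2 <;>
        rcases min_cases x' 1 with h3 | h3 <;> rcases min_cases x 1 with h4 | h4 <;> linarith

/-- `borellJ` is `1`-Lipschitz in each variable, since the probability that a standard Gaussian
variable lies between two quantiles is the difference of the levels. -/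
theorem abs_borellJ_sub_le {ρ : ℝ} (h₁ : -1 < ρ) (h₂ : ρ < 1) (x y x' y' : ℝ) :
    |borellJ x y ρ - borellJ x' y' ρ| ≤ |x - x'| + |y - y'| := by
  have key : ∀ x x' y : ℝ, |borellJ x y ρ - borellJ x' y ρ| ≤ |x - x'| := by
    intro x x' y
    wlog h : x ≤ x' generalizing x x'
    · rw [abs_sub_comm, abs_sub_comm x]
      exact this x' x (le_of_not_ge h)
    rw [abs_sub_comm, abs_sub_comm x, abs_of_nonneg (sub_nonneg.2 h),
      abs_of_nonneg (sub_nonneg.2 (borellJ_mono_left h y ρ))]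
    exact borellJ_sub_le_left h y ρ
  calc |borellJ x y ρ - borellJ x' y' ρ|
      ≤ |borellJ x y ρ - borellJ x' y ρ| + |borellJ x' y ρ - borellJ x' y' ρ| := abs_sub_le _ _ _
    _ ≤ |x - x'| + |y - y'| := by
        refine add_le_add (key x x' y) ?_
        rw [borellJ_comm h₁ h₂ x' y, borellJ_comm h₁ h₂ x' y']
        exact key y y' x'

/-! ### `borellJ` in the coordinates `x = Φ(s)`, `y = Φ(t)` -/

/-- The distribution function `H(s, t) = Pr(U ≤ s, V ≤ t)` of a pair of `ρ`-correlated standard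
Gaussian variables. -/
noncomputable def corrNormalCDF (ρ s t : ℝ) : ℝ :=
  borellJ (stdNormalCDF s) (stdNormalCDF t) ρ

theorem corrNormalCDF_comm {ρ : ℝ} (h₁ : -1 < ρ) (h₂ : ρ < 1) (s t : ℝ) :
    corrNormalCDF ρ s t = corrNormalCDF ρ t s := borellJ_comm h₁ h₂ _ _

/-- Conditioning on the first variable. -/
theorem corrNormalCDF_eq_integral {ρ : ℝ} (h₁ : -1 < ρ) (h₂ : ρ < 1) (s t : ℝ) :
    corrNormalCDF ρ s t = ∫ u in Set.Iic s,
      stdNormalPDF u * stdNormalCDF ((t - ρ * u) / Real.sqrt (1 - ρ ^ 2)) := by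
  set r := Real.sqrt (1 - ρ ^ 2) with hr
  have hr0 : 0 < r := Real.sqrt_pos.2 (by nlinarith)
  have hm : MeasurableSet {p : ℝ × ℝ | p.1 ≤ s ∧ p.2 ≤ t} :=
    (measurableSet_Iic.preimage measurable_fst).inter (measurableSet_Iic.preimage measurable_snd)
  have hm' : MeasurableSet {p : ℝ × ℝ | p.1 ≤ s ∧ ρ * p.1 + r * p.2 ≤ t} :=
    hm.preimage (measurable_correlate (E := ℝ) ρ)
  have hsec : ∀ u, (stdGaussian ℝ).real
      (Prod.mk u ⁻¹' {p : ℝ × ℝ | p.1 ≤ s ∧ ρ * p.1 + r * p.2 ≤ t})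
      = (Set.Iic s).indicator (fun u => stdNormalCDF ((t - ρ * u) / r)) u := by
    intro u
    by_cases hu : u ≤ s
    · rw [Set.indicator_of_mem (Set.mem_Iic.2 hu), stdNormalCDF_eq_real_Iic]
      congr 1
      ext v
      simp only [Set.mem_preimage, Set.mem_ofPred_eq, hu, true_and, Set.mem_Iic]
      rw [le_div_iff₀ hr0, le_sub_iff_add_le', mul_comm v]
    · rw [Set.indicator_of_notMem (by simpa using hu)]
      simp [hu]
  rw [corrNormalCDF, borellJ, stdNormalQuantile_stdNormalCDF, stdNormalQuantile_stdNormalCDF]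
  simp only [EReal.coe_le_coe_iff]
  rw [corrGaussian, map_measureReal_apply (measurable_correlate ρ) hm]
  change ((stdGaussian ℝ).prod (stdGaussian ℝ)).real
    {p : ℝ × ℝ | p.1 ≤ s ∧ ρ * p.1 + r * p.2 ≤ t} = _
  rw [measureReal_def, Measure.prod_apply hm',
    ← integral_toReal (measurable_measure_prodMk_left hm').aemeasurable
      (.of_forall fun _ => measure_lt_top _ _)]
  simp_rw [← measureReal_def]
  simp_rw [hsec]
  rw [integral_indicator measurableSet_Iic, stdGaussian_real,
    ← integral_indicator measurableSet_Iic,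
    integral_gaussianReal_eq_integral_smul one_ne_zero, ← integral_indicator measurableSet_Iic]
  congr 1
  ext u
  by_cases hu : u ∈ Set.Iic s
  · simp [Set.indicator_of_mem hu, stdNormalPDF]
  · simp [Set.indicator_of_notMem hu]

theorem hasDerivAt_corrNormalCDF_left {ρ : ℝ} (h₁ : -1 < ρ) (h₂ : ρ < 1) (s t : ℝ) :
    HasDerivAt (fun s => corrNormalCDF ρ s t)
      (stdNormalPDF s * stdNormalCDF ((t - ρ * s) / Real.sqrt (1 - ρ ^ 2))) s := by
  simp_rw [corrNormalCDF_eq_integral h₁ h₂]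
  have hc : Continuous fun u => stdNormalPDF u *
      stdNormalCDF ((t - ρ * u) / Real.sqrt (1 - ρ ^ 2)) :=
    continuous_stdNormalPDF.mul (continuous_stdNormalCDF.comp (by fun_prop))
  refine hasDerivAt_integral_Iic hc ?_ s
  refine (integrable_gaussianPDFReal 0 1).mono' hc.aestronglyMeasurable (.of_forall fun u => ?_)
  rw [norm_mul, Real.norm_of_nonneg (stdNormalPDF_pos u).le,
    Real.norm_of_nonneg (stdNormalCDF_mem_Ioo _).1.le]
  exact mul_le_of_le_one_right (stdNormalPDF_pos u).le (stdNormalCDF_mem_Ioo _).2.le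

theorem hasFDerivAt_corrNormalCDF {ρ : ℝ} (h₁ : -1 < ρ) (h₂ : ρ < 1) (p : ℝ × ℝ) :
    HasFDerivAt (fun p : ℝ × ℝ => corrNormalCDF ρ p.1 p.2)
      ((ContinuousLinearMap.toSpanSingleton ℝ (stdNormalPDF p.1 *
          stdNormalCDF ((p.2 - ρ * p.1) / Real.sqrt (1 - ρ ^ 2)))).coprod
        (ContinuousLinearMap.toSpanSingleton ℝ (stdNormalPDF p.2 *
          stdNormalCDF ((p.1 - ρ * p.2) / Real.sqrt (1 - ρ ^ 2))))) p := by
  have hc : ∀ {a b : ℝ × ℝ → ℝ}, Continuous a → Continuous b → Continuous fun q : ℝ × ℝ =>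
      ContinuousLinearMap.toSpanSingleton ℝ (stdNormalPDF (a q) *
        stdNormalCDF ((b q - ρ * a q) / Real.sqrt (1 - ρ ^ 2))) := fun ha hb =>
    (ContinuousLinearMap.toSpanSingletonCLE (𝕜 := ℝ) (E := ℝ)).continuous.comp
      ((continuous_stdNormalPDF.comp ha).mul (continuous_stdNormalCDF.comp (by fun_prop)))
  refine (hasStrictFDerivAt_uncurry_coprod (f := corrNormalCDF ρ)
    (f₁ := fun s t => ContinuousLinearMap.toSpanSingleton ℝ (stdNormalPDF s *
          stdNormalCDF ((t - ρ * s) / Real.sqrt (1 - ρ ^ 2))))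
    (f₂ := fun s t => ContinuousLinearMap.toSpanSingleton ℝ (stdNormalPDF t *
          stdNormalCDF ((s - ρ * t) / Real.sqrt (1 - ρ ^ 2))))
    (.of_forall fun v => ?_) (.of_forall fun v => ?_) ?_ ?_).hasFDerivAt
  · exact (hasDerivAt_corrNormalCDF_left h₁ h₂ v.1 v.2).hasFDerivAt
  · have := (hasDerivAt_corrNormalCDF_left h₁ h₂ v.2 v.1).hasFDerivAt
    simp_rw [corrNormalCDF_comm h₁ h₂ _ v.1] at this
    exact this
  · exact (hc continuous_fst continuous_snd).continuousAt
  · exact (hc continuous_snd continuous_fst).continuousAt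

/-! ### The second-order expansion of `borellJ` -/

/-- The real-valued inverse of `stdNormalCDF` on `(0, 1)`. -/
noncomputable def probit (x : ℝ) : ℝ := (stdNormalQuantile x).toReal

theorem probit_stdNormalCDF (t : ℝ) : probit (stdNormalCDF t) = t := by
  rw [probit, stdNormalQuantile_stdNormalCDF, EReal.toReal_coe]

theorem stdNormalCDF_probit {x : ℝ} (hx : x ∈ Set.Ioo (0 : ℝ) 1) :
    stdNormalCDF (probit x) = x := by
  obtain ⟨t, rfl⟩ := exists_stdNormalCDF_eq hx
  rw [probit_stdNormalCDF]

theorem hasDerivAt_probit {x : ℝ} (hx : x ∈ Set.Ioo (0 : ℝ) 1) :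
    HasDerivAt probit (stdNormalPDF (probit x))⁻¹ x := by
  have hs : HasStrictDerivAt stdNormalCDF (stdNormalPDF (probit x)) (probit x) :=
    hasStrictDerivAt_of_hasDerivAt_of_continuousAt (.of_forall hasDerivAt_stdNormalCDF)
      continuous_stdNormalPDF.continuousAt
  have := hs.to_local_left_inverse (stdNormalPDF_pos _).ne' (.of_forall probit_stdNormalCDF)
  rw [stdNormalCDF_probit hx] at this
  exact this.hasDerivAt

theorem contDiffOn_probit : ContDiffOn ℝ 1 probit (Set.Ioo 0 1) := by
  have hd : DifferentiableOn ℝ probit (Set.Ioo 0 1) := fun x hx =>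
    (hasDerivAt_probit hx).differentiableAt.differentiableWithinAt
  rw [show (1 : WithTop ℕ∞) = 0 + 1 by simp, contDiffOn_succ_iff_deriv_of_isOpen isOpen_Ioo]
  refine ⟨hd, by simp, contDiffOn_zero.2 ?_⟩
  refine ContinuousOn.congr (f := fun x => (stdNormalPDF (probit x))⁻¹) ?_
    fun x hx => (hasDerivAt_probit hx).deriv
  exact (continuous_stdNormalPDF.comp_continuousOn hd.continuousOn).inv₀
    fun x _ => (stdNormalPDF_pos _).ne'

/-- The joint density of a pair of `ρ`-correlated standard Gaussian variables. -/
noncomputable def corrNormalPDF (ρ s t : ℝ) : ℝ :=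
  stdNormalPDF s * stdNormalPDF ((t - ρ * s) / Real.sqrt (1 - ρ ^ 2)) / Real.sqrt (1 - ρ ^ 2)

theorem corrNormalPDF_nonneg (ρ s t : ℝ) : 0 ≤ corrNormalPDF ρ s t :=
  div_nonneg (mul_pos (stdNormalPDF_pos _) (stdNormalPDF_pos _)).le (Real.sqrt_nonneg _)

theorem corrNormalPDF_comm {ρ : ℝ} (h₁ : -1 < ρ) (h₂ : ρ < 1) (s t : ℝ) :
    corrNormalPDF ρ s t = corrNormalPDF ρ t s := by
  have hr : 0 < 1 - ρ ^ 2 := by nlinarith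
  have h : ∀ s t : ℝ, corrNormalPDF ρ s t = (Real.sqrt (2 * Real.pi))⁻¹ ^ 2 *
      Real.exp (-(s ^ 2 - 2 * ρ * s * t + t ^ 2) / (2 * (1 - ρ ^ 2))) / Real.sqrt (1 - ρ ^ 2) := by
    intro s t
    rw [corrNormalPDF, stdNormalPDF_eq, stdNormalPDF_eq, div_pow, Real.sq_sqrt hr.le,
      mul_mul_mul_comm, ← Real.exp_add, ← sq]
    congr 3
    field_simp
    ring
  rw [h, h]
  congr 4
  ring

/-- The joint density divided by `φ(probit (i z)) φ(probit (j z))`, where `φ` is the standard normal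
density and `i`, `j` are coordinate functions. For `i ≠ j` this is the mixed second derivative of
`borellJ`, and for `i = j` its product with `-ρ` is the pure second derivative. -/
noncomputable def borellHess (ρ : ℝ) (i j : ℝ × ℝ → ℝ) (z : ℝ × ℝ) : ℝ :=
  corrNormalPDF ρ (probit z.1) (probit z.2) /
    (stdNormalPDF (probit (i z)) * stdNormalPDF (probit (j z)))

theorem contDiffOn_borellHess (ρ : ℝ) {i j : ℝ × ℝ → ℝ} (hi : ContDiff ℝ 1 i)
    (hj : ContDiff ℝ 1 j) {S : Set (ℝ × ℝ)} (hS : S ⊆ Set.Ioo 0 1 ×ˢ Set.Ioo 0 1)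
    (hiS : ∀ z ∈ S, i z ∈ Set.Ioo (0 : ℝ) 1) (hjS : ∀ z ∈ S, j z ∈ Set.Ioo (0 : ℝ) 1) :
    ContDiffOn ℝ 1 (borellHess ρ i j) S := by
  have hφ : ContDiff ℝ 1 stdNormalPDF := contDiff_stdNormalPDF
  have h1 : ContDiffOn ℝ 1 (fun z : ℝ × ℝ => probit z.1) S :=
    contDiffOn_probit.comp contDiffOn_fst fun z hz => (hS hz).1
  have h2 : ContDiffOn ℝ 1 (fun z : ℝ × ℝ => probit z.2) S :=
    contDiffOn_probit.comp contDiffOn_snd fun z hz => (hS hz).2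
  have h3 : ContDiffOn ℝ 1 (fun z : ℝ × ℝ => probit (i z)) S :=
    contDiffOn_probit.comp hi.contDiffOn hiS
  have h4 : ContDiffOn ℝ 1 (fun z : ℝ × ℝ => probit (j z)) S :=
    contDiffOn_probit.comp hj.contDiffOn hjS
  refine ContDiffOn.div (((hφ.comp_contDiffOn h1).mul (hφ.comp_contDiffOn ?_)).div_const _)
    ((hφ.comp_contDiffOn h3).mul (hφ.comp_contDiffOn h4))
    fun z _ => (mul_pos (stdNormalPDF_pos _) (stdNormalPDF_pos _)).ne'
  exact (h2.sub (contDiffOn_const.mul h1)).div_const _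

/-- Lipschitz control of the second derivatives in the interior of the square. -/
theorem exists_lipschitz_borellHess (ρ : ℝ) {i j : ℝ × ℝ → ℝ} (hi : ContDiff ℝ 1 i)
    (hj : ContDiff ℝ 1 j) {ε : ℝ} (hε : 0 < ε)
    (hiS : ∀ z ∈ Set.Icc ε (1 - ε) ×ˢ Set.Icc ε (1 - ε), i z ∈ Set.Icc ε (1 - ε))
    (hjS : ∀ z ∈ Set.Icc ε (1 - ε) ×ˢ Set.Icc ε (1 - ε), j z ∈ Set.Icc ε (1 - ε)) :
    ∃ C : ℝ, 0 ≤ C ∧ ∀ z ∈ Set.Icc ε (1 - ε) ×ˢ Set.Icc ε (1 - ε),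
      |borellHess ρ i j z| ≤ C ∧ ∀ z' ∈ Set.Icc ε (1 - ε) ×ˢ Set.Icc ε (1 - ε),
        |borellHess ρ i j z' - borellHess ρ i j z| ≤ C * (|z'.1 - z.1| + |z'.2 - z.2|) := by
  have hsub : Set.Icc ε (1 - ε) ⊆ Set.Ioo 0 1 := fun x hx =>
    ⟨hε.trans_le hx.1, hx.2.trans_lt (by linarith)⟩
  have hcd := contDiffOn_borellHess ρ hi hj (Set.prod_mono hsub hsub)
    (fun z hz => hsub (hiS z hz)) (fun z hz => hsub (hjS z hz))
  have hK : IsCompact (Set.Icc ε (1 - ε) ×ˢ Set.Icc ε (1 - ε)) := isCompact_Icc.prod isCompact_Icc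
  obtain ⟨K, hL⟩ := hcd.exists_lipschitzOnWith one_ne_zero
    ((convex_Icc _ _).prod (convex_Icc _ _)) hK
  obtain ⟨B, hB⟩ := hK.exists_bound_of_continuousOn hcd.continuousOn
  refine ⟨max K B, le_max_of_le_left K.2, fun z hz => ⟨(hB z hz).trans (le_max_right _ _),
    fun z' hz' => ?_⟩⟩
  have h := hL.dist_le_mul z' hz' z hz
  rw [Real.dist_eq, Prod.dist_eq, Real.dist_eq, Real.dist_eq] at h
  exact h.trans (mul_le_mul (le_max_left _ _) (max_le_add_of_nonneg (abs_nonneg _) (abs_nonneg _))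
    (by positivity) (le_max_of_le_left K.2))

theorem hasDerivAt_borellJ_segment {ρ : ℝ} (h₁ : -1 < ρ) (h₂ : ρ < 1) {x y a b θ : ℝ}
    (hx : x + θ * a ∈ Set.Ioo (0 : ℝ) 1) (hy : y + θ * b ∈ Set.Ioo (0 : ℝ) 1) :
    HasDerivAt (fun θ => borellJ (x + θ * a) (y + θ * b) ρ)
      (stdNormalCDF ((probit (y + θ * b) - ρ * probit (x + θ * a)) / Real.sqrt (1 - ρ ^ 2)) * a +
       stdNormalCDF ((probit (x + θ * a) - ρ * probit (y + θ * b)) / Real.sqrt (1 - ρ ^ 2)) * b)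
      θ := by
  have hlin : ∀ c d : ℝ, HasDerivAt (fun θ => c + θ * d) d θ := fun c d => by
    simpa using ((hasDerivAt_id θ).mul_const d).const_add c
  have hs : HasDerivAt (fun θ => probit (x + θ * a)) _ θ :=
    HasDerivAt.comp θ (hasDerivAt_probit hx) (hlin x a)
  have ht : HasDerivAt (fun θ => probit (y + θ * b)) _ θ :=
    HasDerivAt.comp θ (hasDerivAt_probit hy) (hlin y b)
  have h := HasFDerivAt.comp_hasDerivAt θ
    (hasFDerivAt_corrNormalCDF h₁ h₂ (probit (x + θ * a), probit (y + θ * b))) (hs.prodMk ht)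
  have he : (fun θ => borellJ (x + θ * a) (y + θ * b) ρ) =ᶠ[𝓝 θ]
      (fun p : ℝ × ℝ => corrNormalCDF ρ p.1 p.2) ∘
        fun θ => (probit (x + θ * a), probit (y + θ * b)) := by
    filter_upwards [(hlin x a).continuousAt.preimage_mem_nhds (isOpen_Ioo.mem_nhds hx),
      (hlin y b).continuousAt.preimage_mem_nhds (isOpen_Ioo.mem_nhds hy)] with τ h1 h2
    simp only [Function.comp_apply, corrNormalCDF]
    rw [stdNormalCDF_probit h1, stdNormalCDF_probit h2]
  refine (h.congr_of_eventuallyEq he).congr_deriv ?_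
  have p1 := (stdNormalPDF_pos (probit (x + θ * a))).ne'
  have p2 := (stdNormalPDF_pos (probit (y + θ * b))).ne'
  simp only [ContinuousLinearMap.coprod_apply, ContinuousLinearMap.toSpanSingleton_apply,
    smul_eq_mul]
  field_simp

theorem hasDerivAt_deriv_borellJ_segment {ρ : ℝ} (h₁ : -1 < ρ) (h₂ : ρ < 1) {x y a b θ : ℝ}
    (hx : x + θ * a ∈ Set.Ioo (0 : ℝ) 1) (hy : y + θ * b ∈ Set.Ioo (0 : ℝ) 1) :
    HasDerivAt (fun θ =>
      stdNormalCDF ((probit (y + θ * b) - ρ * probit (x + θ * a)) / Real.sqrt (1 - ρ ^ 2)) * a +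
       stdNormalCDF ((probit (x + θ * a) - ρ * probit (y + θ * b)) / Real.sqrt (1 - ρ ^ 2)) * b)
      (-ρ * borellHess ρ Prod.fst Prod.fst (x + θ * a, y + θ * b) * a ^ 2 +
        2 * borellHess ρ Prod.fst Prod.snd (x + θ * a, y + θ * b) * (a * b) -
        ρ * borellHess ρ Prod.snd Prod.snd (x + θ * a, y + θ * b) * b ^ 2) θ := by
  have hlin : ∀ c d : ℝ, HasDerivAt (fun θ => c + θ * d) d θ := fun c d => by
    simpa using ((hasDerivAt_id θ).mul_const d).const_add c
  have hs : HasDerivAt (fun θ => probit (x + θ * a)) _ θ :=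
    HasDerivAt.comp θ (hasDerivAt_probit hx) (hlin x a)
  have ht : HasDerivAt (fun θ => probit (y + θ * b)) _ θ :=
    HasDerivAt.comp θ (hasDerivAt_probit hy) (hlin y b)
  have h1 := (HasDerivAt.comp θ (hasDerivAt_stdNormalCDF _)
    ((ht.sub (hs.const_mul ρ)).div_const (Real.sqrt (1 - ρ ^ 2)))).mul_const a
  have h2 := (HasDerivAt.comp θ (hasDerivAt_stdNormalCDF _)
    ((hs.sub (ht.const_mul ρ)).div_const (Real.sqrt (1 - ρ ^ 2)))).mul_const b
  refine (h1.add h2).congr_deriv ?_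
  simp only [borellHess, Pi.sub_apply]
  set s := probit (x + θ * a)
  set t := probit (y + θ * b)
  have hr : Real.sqrt (1 - ρ ^ 2) ≠ 0 := (Real.sqrt_pos.2 (by nlinarith)).ne'
  have p1 := (stdNormalPDF_pos s).ne'
  have p2 := (stdNormalPDF_pos t).ne'
  have e1 : stdNormalPDF ((t - ρ * s) / Real.sqrt (1 - ρ ^ 2)) =
      corrNormalPDF ρ s t * Real.sqrt (1 - ρ ^ 2) / stdNormalPDF s := by
    rw [corrNormalPDF]
    field_simp
  have e2 : stdNormalPDF ((s - ρ * t) / Real.sqrt (1 - ρ ^ 2)) =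
      corrNormalPDF ρ s t * Real.sqrt (1 - ρ ^ 2) / stdNormalPDF t := by
    rw [corrNormalPDF_comm h₁ h₂, corrNormalPDF]
    field_simp
  rw [e1, e2]
  field_simp
  ring

/-- Taylor's formula of order two on `[0, 1]`, where `M` bounds the oscillation of `u'' = w`. -/
theorem abs_taylor_two_le {u v w : ℝ → ℝ} {M : ℝ}
    (hu : ∀ θ ∈ Set.Icc (0 : ℝ) 1, HasDerivAt u (v θ) θ)
    (hv : ∀ θ ∈ Set.Icc (0 : ℝ) 1, HasDerivAt v (w θ) θ)
    (hw : ∀ θ ∈ Set.Icc (0 : ℝ) 1, |w θ - w 0| ≤ M) :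
    |u 1 - u 0 - v 0 - w 0 / 2| ≤ M := by
  have h0 : (0 : ℝ) ∈ Set.Icc (0 : ℝ) 1 := by simp
  have h1 : (1 : ℝ) ∈ Set.Icc (0 : ℝ) 1 := by simp
  have hM : 0 ≤ M := (abs_nonneg _).trans (hw 0 h0)
  have hk : ∀ θ ∈ Set.Icc (0 : ℝ) 1, |v θ - v 0 - w 0 * θ| ≤ M := by
    intro θ hθ
    have := (convex_Icc (0 : ℝ) 1).norm_image_sub_le_of_norm_hasDerivWithin_le
      (f := fun θ => v θ - w 0 * θ) (f' := fun θ => w θ - w 0)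
      (fun τ hτ => ((hv τ hτ).sub
        (by simpa using (hasDerivAt_id τ).const_mul (w 0))).hasDerivWithinAt) hw h0 hθ
    simp only [Real.norm_eq_abs, mul_zero, sub_zero, abs_of_nonneg hθ.1] at this
    rw [show v θ - v 0 - w 0 * θ = v θ - w 0 * θ - v 0 by ring]
    exact this.trans (mul_le_of_le_one_right hM hθ.2)
  have := (convex_Icc (0 : ℝ) 1).norm_image_sub_le_of_norm_hasDerivWithin_le
      (f := fun θ => u θ - v 0 * θ - w 0 / 2 * θ ^ 2) (f' := fun θ => v θ - v 0 - w 0 * θ)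
      (fun τ hτ => ((((hu τ hτ).sub ((hasDerivAt_id τ).const_mul (v 0))).sub
        ((hasDerivAt_pow 2 τ).const_mul (w 0 / 2))).congr_deriv
          (by simp; ring)).hasDerivWithinAt) hk h0 h1
  simp only [Real.norm_eq_abs] at this
  calc _ = _ := by congr 1; ring
    _ ≤ _ := this
    _ = M := by simp

/-- Second-order Taylor expansion of `borellJ` in the interior of the square, with a uniform cubic
remainder. Once its cross term is multiplied by `ρ`, the Hessian degenerates to a multiple of a
perfect square whose sign is that of `-ρ`. -/
theorem exists_borellJ_taylor {ρ : ℝ} (h₁ : -1 < ρ) (h₂ : ρ < 1) {ε : ℝ} (hε : 0 < ε) :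
    ∃ C : ℝ, ∀ x ∈ Set.Icc ε (1 - ε), ∀ y ∈ Set.Icc ε (1 - ε), ∃ α β p q r : ℝ,
      |p| ≤ C ∧ |q| ≤ C ∧ |r| ≤ C ∧
      (∃ k, 0 ≤ k ∧ ∃ c d, ∀ a b : ℝ, p * a ^ 2 + 2 * ρ * q * (a * b) + r * b ^ 2 =
        -ρ * k * (c * a - d * b) ^ 2) ∧
      ∀ x' ∈ Set.Icc ε (1 - ε), ∀ y' ∈ Set.Icc ε (1 - ε),
        |borellJ x' y' ρ - borellJ x y ρ - (α * (x' - x) + β * (y' - y)) -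
          (p * (x' - x) ^ 2 + 2 * q * ((x' - x) * (y' - y)) + r * (y' - y) ^ 2) / 2| ≤
            C * (|x' - x| + |y' - y|) ^ 3 := by
  obtain ⟨C₁, hC₁, H₁⟩ := exists_lipschitz_borellHess ρ contDiff_fst contDiff_fst hε
    (fun z hz => hz.1) (fun z hz => hz.1)
  obtain ⟨C₂, hC₂, H₂⟩ := exists_lipschitz_borellHess ρ contDiff_fst contDiff_snd hε
    (fun z hz => hz.1) (fun z hz => hz.2)
  obtain ⟨C₃, hC₃, H₃⟩ := exists_lipschitz_borellHess ρ contDiff_snd contDiff_snd hε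
    (fun z hz => hz.2) (fun z hz => hz.2)
  have hρ : |ρ| ≤ 1 := abs_le.2 ⟨h₁.le, h₂.le⟩
  have hmul : ∀ {c D : ℝ}, |c| ≤ D → |(-ρ) * c| ≤ D := fun {c D} h => by
    rw [abs_mul, abs_neg]
    nlinarith [abs_nonneg c, abs_nonneg ρ]
  refine ⟨C₁ + C₂ + C₃, fun x hx y hy => ?_⟩
  have hz : (x, y) ∈ Set.Icc ε (1 - ε) ×ˢ Set.Icc ε (1 - ε) := ⟨hx, hy⟩
  refine ⟨stdNormalCDF ((probit y - ρ * probit x) / Real.sqrt (1 - ρ ^ 2)),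
    stdNormalCDF ((probit x - ρ * probit y) / Real.sqrt (1 - ρ ^ 2)),
    -ρ * borellHess ρ Prod.fst Prod.fst (x, y), borellHess ρ Prod.fst Prod.snd (x, y),
    -ρ * borellHess ρ Prod.snd Prod.snd (x, y), (hmul (H₁ _ hz).1).trans (by linarith),
    (H₂ _ hz).1.trans (by linarith), (hmul (H₃ _ hz).1).trans (by linarith),
    ⟨corrNormalPDF ρ (probit x) (probit y), corrNormalPDF_nonneg _ _ _,
      (stdNormalPDF (probit x))⁻¹, (stdNormalPDF (probit y))⁻¹, fun a b => ?_⟩,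
    fun x' hx' y' hy' => ?_⟩
  · simp only [borellHess]
    have p1 := (stdNormalPDF_pos (probit x)).ne'
    have p2 := (stdNormalPDF_pos (probit y)).ne'
    field_simp
    ring
  set a := x' - x with ha
  set b := y' - y with hb
  have hseg : ∀ {x x' : ℝ}, x ∈ Set.Icc ε (1 - ε) → x' ∈ Set.Icc ε (1 - ε) →
      ∀ θ ∈ Set.Icc (0 : ℝ) 1, x + θ * (x' - x) ∈ Set.Icc ε (1 - ε) := fun h h' θ hθ =>
    (convex_Icc ε (1 - ε)).add_smul_sub_mem h h' hθ
  have hsub : ∀ {x : ℝ}, x ∈ Set.Icc ε (1 - ε) → x ∈ Set.Ioo (0 : ℝ) 1 := fun hx =>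
    ⟨hε.trans_le hx.1, hx.2.trans_lt (by linarith)⟩
  have key := abs_taylor_two_le (M := (C₁ + C₂ + C₃) * (|a| + |b|) ^ 3)
    (fun θ hθ => hasDerivAt_borellJ_segment h₁ h₂ (hsub (hseg hx hx' θ hθ))
      (hsub (hseg hy hy' θ hθ)))
    (fun θ hθ => hasDerivAt_deriv_borellJ_segment h₁ h₂ (hsub (hseg hx hx' θ hθ))
      (hsub (hseg hy hy' θ hθ))) ?_
  · rw [← ha, ← hb] at key
    simp only [one_mul, zero_mul, add_zero] at key
    convert key using 2
    rw [ha, hb, add_sub_cancel, add_sub_cancel]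
    ring
  · intro θ hθ
    rw [← ha, ← hb]
    simp only [zero_mul, add_zero]
    have hz' : (x + θ * a, y + θ * b) ∈ Set.Icc ε (1 - ε) ×ˢ Set.Icc ε (1 - ε) :=
      ⟨hseg hx hx' θ hθ, hseg hy hy' θ hθ⟩
    have hle : ∀ {D c : ℝ}, 0 ≤ D → |c| ≤ D * (|x + θ * a - x| + |y + θ * b - y|) →
        |c| ≤ D * (|a| + |b|) := by
      intro D c hD h
      refine h.trans (mul_le_mul_of_nonneg_left ?_ hD)
      rw [add_sub_cancel_left, add_sub_cancel_left, abs_mul, abs_mul, abs_of_nonneg hθ.1]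
      exact add_le_add (mul_le_of_le_one_left (abs_nonneg _) hθ.2)
        (mul_le_of_le_one_left (abs_nonneg _) hθ.2)
    have g1 := hmul (hle hC₁ ((H₁ _ hz).2 _ hz'))
    have g2 := hle hC₂ ((H₂ _ hz).2 _ hz')
    have g3 := hmul (hle hC₃ ((H₃ _ hz).2 _ hz'))
    set d1 := borellHess ρ Prod.fst Prod.fst (x + θ * a, y + θ * b) -
      borellHess ρ Prod.fst Prod.fst (x, y)
    set d2 := borellHess ρ Prod.fst Prod.snd (x + θ * a, y + θ * b) -
      borellHess ρ Prod.fst Prod.snd (x, y)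
    set d3 := borellHess ρ Prod.snd Prod.snd (x + θ * a, y + θ * b) -
      borellHess ρ Prod.snd Prod.snd (x, y)
    calc _ = |-ρ * d1 * a ^ 2 + 2 * d2 * (a * b) + -ρ * d3 * b ^ 2| := by
          congr 1
          ring
      _ ≤ |-ρ * d1| * |a| ^ 2 + 2 * |d2| * (|a| * |b|) + |-ρ * d3| * |b| ^ 2 := by
          refine (abs_add_three _ _ _).trans_eq ?_
          simp only [abs_mul, abs_pow, Nat.abs_ofNat]
      _ ≤ C₁ * (|a| + |b|) * |a| ^ 2 + 2 * (C₂ * (|a| + |b|)) * (|a| * |b|) +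
          C₃ * (|a| + |b|) * |b| ^ 2 := by gcongr
      _ ≤ (C₁ + C₂ + C₃) * (|a| + |b|) ^ 3 := by
          have hA := abs_nonneg a
          have hB := abs_nonneg b
          have : (C₁ + C₂ + C₃) * (|a| + |b|) ^ 3 - (C₁ * (|a| + |b|) * |a| ^ 2 +
              2 * (C₂ * (|a| + |b|)) * (|a| * |b|) + C₃ * (|a| + |b|) * |b| ^ 2) =
              (|a| + |b|) * (C₁ * (2 * (|a| * |b|) + |b| ^ 2) + C₂ * (|a| ^ 2 + |b| ^ 2) +
                C₃ * (|a| ^ 2 + 2 * (|a| * |b|))) := by ring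
          have h0 : 0 ≤ (|a| + |b|) * (C₁ * (2 * (|a| * |b|) + |b| ^ 2) +
              C₂ * (|a| ^ 2 + |b| ^ 2) + C₃ * (|a| ^ 2 + 2 * (|a| * |b|))) := by positivity
          linarith

/-! ### Gaussian increments and the local concavity condition -/

section Increments

open scoped InnerProductSpace

variable {E : Type*} [NormedAddCommGroup E] [InnerProductSpace ℝ E]

/-- A Lipschitz function with values in `[ε, 1 - ε]` whose first-order expansion has a quadratic
error; `L` bounds all the constants. The gradient is only asked to be measurable, which is what the
heat flow needs in order to preserve the class. -/
structure IsTame [MeasurableSpace E] (ε L : ℝ) (f : E → ℝ) : Prop where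
  mem_Icc : ∀ x, f x ∈ Set.Icc ε (1 - ε)
  abs_sub_le : ∀ x v, |f (x + v) - f x| ≤ L * ‖v‖
  exists_gradient : ∃ a : E → E, Measurable a ∧ (∀ x, ‖a x‖ ≤ L) ∧
    ∀ x v, |f (x + v) - f x - ⟪a x, v⟫_ℝ| ≤ L * ‖v‖ ^ 2

/-- Near each point of `D × D`, the function `K` lies below a quadratic polynomial up to a cubic
error, and that polynomial satisfies the concavity condition `p a² + 2 ρ q a b + r b² ≤ 0`. For
smooth `K` this says that the Hessian of `K` with its off-diagonal entries multiplied by `ρ` is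
negative semidefinite. The constant `C` is uniform in the point. -/
def HasConcaveTaylor (K : ℝ → ℝ → ℝ) (ρ : ℝ) (D : Set ℝ) (C : ℝ) : Prop :=
  ∀ x ∈ D, ∀ y ∈ D, ∃ α β p q r : ℝ, |p| ≤ C ∧ |q| ≤ C ∧ |r| ≤ C ∧
    (∀ a b : ℝ, p * a ^ 2 + 2 * ρ * q * (a * b) + r * b ^ 2 ≤ 0) ∧
    ∀ x' ∈ D, ∀ y' ∈ D, K x' y' ≤ K x y + (α * (x' - x) + β * (y' - y)) +
      (p * (x' - x) ^ 2 + 2 * q * ((x' - x) * (y' - y)) + r * (y' - y) ^ 2) / 2 +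
        C * (|x' - x| + |y' - y|) ^ 3

/-- The scalar concavity condition implies the vector one: the form is affine in the inner product,
whose extreme values `±‖a‖ ‖b‖` are attained by scalars. -/
theorem quadratic_inner_nonpos {ρ p q r : ℝ}
    (h : ∀ a b : ℝ, p * a ^ 2 + 2 * ρ * q * (a * b) + r * b ^ 2 ≤ 0) (a b : E) :
    p * ‖a‖ ^ 2 + 2 * ρ * q * ⟪a, b⟫_ℝ + r * ‖b‖ ^ 2 ≤ 0 := by
  have h1 := h ‖a‖ ‖b‖
  have h2 := h ‖a‖ (-‖b‖)
  obtain ⟨h3, h4⟩ := abs_le.1 (abs_real_inner_le_norm a b)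
  rcases le_total 0 (2 * ρ * q) with hc | hc
  · nlinarith
  · nlinarith

namespace IsTame

variable [MeasurableSpace E] {ε L : ℝ} {f : E → ℝ}

theorem continuous (hf : IsTame ε L f) : Continuous f := by
  have : LipschitzWith L.toNNReal f := LipschitzWith.of_dist_le_mul fun x y => by
    have := hf.abs_sub_le y (x - y)
    rw [add_sub_cancel] at this
    rw [Real.dist_eq, dist_eq_norm]
    exact this.trans (mul_le_mul_of_nonneg_right (Real.le_coe_toNNReal L) (norm_nonneg _))
  exact this.continuous

theorem nonneg (hf : IsTame ε L f) : 0 ≤ L := by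
  obtain ⟨a, -, ha, -⟩ := hf.exists_gradient
  exact (norm_nonneg _).trans (ha 0)

theorem mono (hf : IsTame ε L f) {ε' L' : ℝ} (hε : ε' ≤ ε) (hL : L ≤ L') : IsTame ε' L' f where
  mem_Icc x := Set.Icc_subset_Icc hε (by linarith) (hf.mem_Icc x)
  abs_sub_le x v := (hf.abs_sub_le x v).trans (by gcongr)
  exists_gradient := by
    obtain ⟨a, h1, h2, h3⟩ := hf.exists_gradient
    exact ⟨a, h1, fun x => (h2 x).trans hL, fun x v => (h3 x v).trans (by gcongr)⟩

theorem abs_le_one (hf : IsTame ε L f) (hε : 0 < ε) (x : E) : |f x| ≤ 1 := by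
  obtain ⟨h1, h2⟩ := hf.mem_Icc x
  exact abs_le.2 ⟨by linarith, by linarith⟩

variable [FiniteDimensional ℝ E] [BorelSpace E]

/-- The heat flow preserves tame functions, with the same constants. -/
theorem heat {μ : Measure E} [IsProbabilityMeasure μ] (hε : 0 < ε) (hf : IsTame ε L f) (s : ℝ) :
    IsTame ε L (heat μ s f) := by
  have hint : ∀ x, Integrable (fun z => f (x + Real.sqrt s • z)) μ := fun x =>
    integrable_comp_add_smul hf.continuous.measurable (hf.abs_le_one hε) x _
  obtain ⟨a, ham, haL, ha⟩ := hf.exists_gradient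
  have haint : ∀ x, Integrable (fun z => a (x + Real.sqrt s • z)) μ := fun x =>
    .of_bound (Measurable.aestronglyMeasurable (by fun_prop)) L (.of_forall fun _ => haL _)
  refine ⟨fun x => ⟨?_, ?_⟩, fun x v => ?_,
    fun x => ∫ z, a (x + Real.sqrt s • z) ∂μ, ?_, fun x => ?_, fun x v => ?_⟩
  · simpa [_root_.heat] using integral_mono (integrable_const ε) (hint x) fun z => (hf.mem_Icc _).1
  · simpa [_root_.heat] using
      integral_mono (hint x) (integrable_const (1 - ε)) fun z => (hf.mem_Icc _).2
  · rw [_root_.heat, _root_.heat, ← integral_sub (hint _) (hint _)]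
    simpa using norm_integral_le_of_norm_le_const (μ := μ) (C := L * ‖v‖)
      (f := fun z => f (x + v + Real.sqrt s • z) - f (x + Real.sqrt s • z))
      (.of_forall fun z => by
        rw [add_right_comm]
        exact hf.abs_sub_le _ v)
  · have : StronglyMeasurable (Function.uncurry fun x z : E => a (x + Real.sqrt s • z)) :=
      Measurable.stronglyMeasurable (by unfold Function.uncurry; fun_prop)
    exact this.integral_prod_right.measurable
  · simpa using norm_integral_le_of_norm_le_const (μ := μ) (C := L)
      (f := fun z => a (x + Real.sqrt s • z)) (.of_forall fun z => haL _)
  · have e : ⟪∫ z, a (x + Real.sqrt s • z) ∂μ, v⟫_ℝ =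
        ∫ z, ⟪a (x + Real.sqrt s • z), v⟫_ℝ ∂μ := by
      rw [real_inner_comm, ← integral_inner (haint x) v]
      simp_rw [real_inner_comm]
    have hi : Integrable (fun z => ⟪a (x + Real.sqrt s • z), v⟫_ℝ) μ := (haint x).inner_const v
    have hd : Integrable (fun z => f (x + v + Real.sqrt s • z) - f (x + Real.sqrt s • z)) μ :=
      (hint _).sub (hint _)
    rw [_root_.heat, _root_.heat, e, ← integral_sub (hint _) (hint _), ← integral_sub hd hi]
    simpa using norm_integral_le_of_norm_le_const (μ := μ) (C := L * ‖v‖ ^ 2)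
      (f := fun z => f (x + v + Real.sqrt s • z) - f (x + Real.sqrt s • z) -
        ⟪a (x + Real.sqrt s • z), v⟫_ℝ)
      (.of_forall fun z => by
        rw [add_right_comm]
        exact ha _ v)

/-- Over a short time the fluctuation of a tame function around its mean is linear up to second
order. The constant `c` bounds the first two absolute moments. -/
theorem exists_increment_bound (hε : 0 < ε) (hf : IsTame ε L f) {c : ℝ} (hc : 1 ≤ c)
    (hc₁ : ∫ z, ‖z‖ ∂(stdGaussian E) ≤ c) (hc₂ : ∫ z, ‖z‖ ^ 2 ∂(stdGaussian E) ≤ c)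
    (δ : ℝ) (x : E) :
    ∃ a : E, ‖a‖ ≤ L ∧ ∀ z, |f (x + Real.sqrt δ • z) - _root_.heat (stdGaussian E) δ f x| ≤
        L * Real.sqrt δ * (c + ‖z‖) ∧
      |f (x + Real.sqrt δ • z) - _root_.heat (stdGaussian E) δ f x - Real.sqrt δ * ⟪a, z⟫_ℝ| ≤
        L * Real.sqrt δ ^ 2 * (c + ‖z‖) ^ 2 := by
  have hL := hf.nonneg
  set d := Real.sqrt δ
  have hd : 0 ≤ d := Real.sqrt_nonneg δ
  have hint : Integrable (fun z => f (x + d • z)) (stdGaussian E) :=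
    integrable_comp_add_smul hf.continuous.measurable (hf.abs_le_one hε) x _
  obtain ⟨a, -, haL, ha⟩ := hf.exists_gradient
  have hi1 : Integrable (fun z : E => ‖z‖) (stdGaussian E) := IsGaussian.integrable_id.norm
  have hi2 : Integrable (fun z : E => ‖z‖ ^ 2) (stdGaussian E) :=
    IsGaussian.memLp_two_id.integrable_norm_pow two_ne_zero
  have m1 : |_root_.heat (stdGaussian E) δ f x - f x| ≤ L * d * c := by
    calc |_root_.heat (stdGaussian E) δ f x - f x|
        = ‖∫ z, (f (x + d • z) - f x) ∂(stdGaussian E)‖ := by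
          rw [integral_sub hint (integrable_const _)]
          simp [_root_.heat, d]
      _ ≤ ∫ z, L * d * ‖z‖ ∂(stdGaussian E) :=
          norm_integral_le_of_norm_le (hi1.const_mul _) (.of_forall fun z => by
            have := hf.abs_sub_le x (d • z)
            rw [norm_smul, Real.norm_of_nonneg hd, ← mul_assoc] at this
            exact this)
      _ ≤ L * d * c := by
          rw [integral_const_mul]
          gcongr
  have hinner : ∫ z, d * ⟪a x, z⟫_ℝ ∂(stdGaussian E) = 0 := by
    rw [integral_const_mul]
    have h0 : ∫ z, ⟪a x, z⟫_ℝ ∂(stdGaussian E) = 0 :=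
      integral_strongDual_stdGaussian (innerSL ℝ (a x))
    rw [h0, mul_zero]
  have hiinner : Integrable (fun z => d * ⟪a x, z⟫_ℝ) (stdGaussian E) :=
    ((memLp_inner_stdGaussian (a x)).integrable (by simp)).const_mul d
  have hlin : ∀ z, |f (x + d • z) - f x - d * ⟪a x, z⟫_ℝ| ≤ L * d ^ 2 * ‖z‖ ^ 2 := fun z => by
    have := ha x (d • z)
    rw [norm_smul, Real.norm_of_nonneg hd, inner_smul_right, mul_pow, ← mul_assoc] at this
    exact this
  have m2 : |_root_.heat (stdGaussian E) δ f x - f x| ≤ L * d ^ 2 * c := by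
    calc |_root_.heat (stdGaussian E) δ f x - f x|
        = ‖∫ z, (f (x + d • z) - f x - d * ⟪a x, z⟫_ℝ) ∂(stdGaussian E)‖ := by
          have hd : Integrable (fun z => f (x + d • z) - f x) (stdGaussian E) :=
            hint.sub (integrable_const _)
          rw [integral_sub hd hiinner, hinner, integral_sub hint (integrable_const _)]
          simp [_root_.heat, d]
      _ ≤ ∫ z, L * d ^ 2 * ‖z‖ ^ 2 ∂(stdGaussian E) :=
          norm_integral_le_of_norm_le (hi2.const_mul _) (.of_forall hlin)
      _ ≤ L * d ^ 2 * c := by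
          rw [integral_const_mul]
          gcongr
  refine ⟨a x, haL x, fun z => ⟨?_, ?_⟩⟩
  · have h1 := hf.abs_sub_le x (d • z)
    rw [norm_smul, Real.norm_of_nonneg hd, ← mul_assoc] at h1
    have h2 := _root_.abs_sub_le (f (x + d • z)) (f x) (_root_.heat (stdGaussian E) δ f x)
    rw [abs_sub_comm (f x)] at h2
    linarith
  · have h1 := hlin z
    have h2 : c + ‖z‖ ^ 2 ≤ (c + ‖z‖) ^ 2 := by nlinarith [norm_nonneg z]
    have h3 : L * d ^ 2 * (c + ‖z‖ ^ 2) ≤ L * d ^ 2 * (c + ‖z‖) ^ 2 := by gcongr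
    rw [show f (x + d • z) - _root_.heat (stdGaussian E) δ f x - d * ⟪a x, z⟫_ℝ =
      (f (x + d • z) - f x - d * ⟪a x, z⟫_ℝ) - (_root_.heat (stdGaussian E) δ f x - f x) by ring]
    have h4 := abs_sub (f (x + d • z) - f x - d * ⟪a x, z⟫_ℝ)
      (_root_.heat (stdGaussian E) δ f x - f x)
    linarith

end IsTame

/-- Replacing the fluctuations `Δᵢ`, of order `d`, by their linear parts `ξᵢ` with an error of order
`d²` changes a quadratic form by `O(d³)`. -/
theorem quadratic_sub_le {p q r C L d G Δ₁ Δ₂ ξ₁ ξ₂ : ℝ} (hp : |p| ≤ C) (hq : |q| ≤ C)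
    (hr : |r| ≤ C) (hd : 0 ≤ d) (hG : 0 ≤ G) (hL : 0 ≤ L) (h₁ : |Δ₁| ≤ L * d * G)
    (h₂ : |Δ₂| ≤ L * d * G)
    (k₁ : |ξ₁| ≤ L * d * G) (k₂ : |ξ₂| ≤ L * d * G) (e₁ : |Δ₁ - ξ₁| ≤ L * d ^ 2 * G ^ 2)
    (e₂ : |Δ₂ - ξ₂| ≤ L * d ^ 2 * G ^ 2) :
    p * Δ₁ ^ 2 + 2 * q * (Δ₁ * Δ₂) + r * Δ₂ ^ 2 ≤
      p * ξ₁ ^ 2 + 2 * q * (ξ₁ * ξ₂) + r * ξ₂ ^ 2 + 8 * C * L ^ 2 * d ^ 3 * G ^ 3 := by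
  have hC : 0 ≤ C := (abs_nonneg p).trans hp
  have hprod : ∀ {u v u' v' : ℝ}, |u| ≤ L * d * G → |v'| ≤ L * d * G →
      |u - u'| ≤ L * d ^ 2 * G ^ 2 → |v - v'| ≤ L * d ^ 2 * G ^ 2 →
      |u * v - u' * v'| ≤ 2 * L ^ 2 * d ^ 3 * G ^ 3 := by
    intro u v u' v' hu hv' h h'
    calc |u * v - u' * v'| = |u * (v - v') + (u - u') * v'| := by congr 1; ring
      _ ≤ |u| * |v - v'| + |u - u'| * |v'| := by
          refine (abs_add_le _ _).trans_eq ?_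
          rw [abs_mul, abs_mul]
      _ ≤ L * d * G * (L * d ^ 2 * G ^ 2) + L * d ^ 2 * G ^ 2 * (L * d * G) := by gcongr
      _ = 2 * L ^ 2 * d ^ 3 * G ^ 3 := by ring
  have hcoef : ∀ {c t : ℝ}, |c| ≤ C → |t| ≤ 2 * L ^ 2 * d ^ 3 * G ^ 3 →
      c * t ≤ C * (2 * L ^ 2 * d ^ 3 * G ^ 3) := fun hc ht =>
    (le_abs_self _).trans ((abs_mul _ _).trans_le (mul_le_mul hc ht (abs_nonneg _) hC))
  have t1 := hcoef hp (hprod h₁ k₁ e₁ e₁)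
  have t2 := hcoef hq (hprod h₁ k₂ e₁ e₂)
  have t3 := hcoef hr (hprod h₂ k₂ e₂ e₂)
  linarith

variable [MeasurableSpace E] [FiniteDimensional ℝ E] [BorelSpace E]

theorem integrable_add_norm_pow_three_corrGaussian (ρ c : ℝ) :
    Integrable (fun z : E × E => (c + (‖z.1‖ + ‖z.2‖)) ^ 3) (corrGaussian E ρ) := by
  have h := IsGaussian.memLp_id (corrGaussian E ρ) 3 (by simp)
  have h1 : MemLp (fun z : E × E => c + (‖z.1‖ + ‖z.2‖)) 3 (corrGaussian E ρ) :=
    (memLp_const c).add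
      (((ContinuousLinearMap.fst ℝ E E).comp_memLp' h).norm.add
        ((ContinuousLinearMap.snd ℝ E E).comp_memLp' h).norm)
  have := h1.integrable_norm_pow (by norm_num : (3 : ℕ) ≠ 0)
  refine (this.mono' (Measurable.aestronglyMeasurable (by fun_prop)) (.of_forall fun z => ?_))
  simp

/-- One Gaussian increment of variance `δ` loses at most `O(δ^{3/2})`: the first-order terms have
mean zero, and the second-order terms have a nonpositive mean by the concavity condition. -/
theorem integral_increment_le {K : ℝ → ℝ → ℝ} (hK : Continuous (Function.uncurry K)) {ρ : ℝ}
    (h₁ : -1 < ρ) (h₂ : ρ < 1) {ε L C : ℝ} (hε : 0 < ε)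
    (hT : HasConcaveTaylor K ρ (Set.Icc ε (1 - ε)) C) :
    ∃ B : ℝ, ∀ f g : E → ℝ, IsTame ε L f → IsTame ε L g → ∀ (δ : ℝ) (x y : E),
      ∫ z, K (f (x + Real.sqrt δ • z.1)) (g (y + Real.sqrt δ • z.2)) ∂(corrGaussian E ρ) ≤
        K (heat (stdGaussian E) δ f x) (heat (stdGaussian E) δ g y) + B * Real.sqrt δ ^ 3 := by
  set m₁ := ∫ z, ‖z‖ ∂(stdGaussian E)
  set m₂ := ∫ z, ‖z‖ ^ 2 ∂(stdGaussian E)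
  have hm₁0 : 0 ≤ m₁ := integral_nonneg fun z => norm_nonneg z
  have hm₂0 : 0 ≤ m₂ := integral_nonneg fun z => by positivity
  set c := 1 + m₁ + m₂ with hc
  set M := ∫ z : E × E, (c + (‖z.1‖ + ‖z.2‖)) ^ 3 ∂(corrGaussian E ρ) with hM
  refine ⟨(4 * C * L ^ 2 + 8 * C * L ^ 3) * M, fun f g hf hg δ x y => ?_⟩
  have hL := hf.nonneg
  obtain ⟨a, haL, ha⟩ := hf.exists_increment_bound hε (c := c) (by linarith) (by linarith)
    (by linarith) δ x
  obtain ⟨b, hbL, hb⟩ := hg.exists_increment_bound hε (c := c) (by linarith) (by linarith)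
    (by linarith) δ y
  have hmx := (hf.heat (μ := stdGaussian E) hε δ).mem_Icc x
  have hmy := (hg.heat (μ := stdGaussian E) hε δ).mem_Icc y
  have hif : Integrable (fun z => f (x + Real.sqrt δ • z)) (stdGaussian E) :=
    integrable_comp_add_smul hf.continuous.measurable (hf.abs_le_one hε) x _
  have hig : Integrable (fun z => g (y + Real.sqrt δ • z)) (stdGaussian E) :=
    integrable_comp_add_smul hg.continuous.measurable (hg.abs_le_one hε) y _
  have hfm : Measurable (fun z => f (x + Real.sqrt δ • z)) :=
    hf.continuous.measurable.comp (by fun_prop)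
  have hgm : Measurable (fun z => g (y + Real.sqrt δ • z)) :=
    hg.continuous.measurable.comp (by fun_prop)
  obtain ⟨α, β, p, q, r, hp, hq, hr, hform, hTay⟩ := hT _ hmx _ hmy
  set m := heat (stdGaussian E) δ f x with hm
  set n := heat (stdGaussian E) δ g y with hn
  set d := Real.sqrt δ with hdd
  have hd : 0 ≤ d := Real.sqrt_nonneg δ
  have hC : 0 ≤ C := (abs_nonneg p).trans hp
  -- The pointwise bound: fluctuations are replaced by their linear parts in the quadratic term.
  have hpt : ∀ z : E × E, K (f (x + d • z.1)) (g (y + d • z.2)) ≤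
      (K m n + (α * (f (x + d • z.1) - m) + β * (g (y + d • z.2) - n))) +
      (d ^ 2 / 2 * (p * (⟪a, z.1⟫_ℝ * ⟪a, z.1⟫_ℝ) + 2 * q * (⟪a, z.1⟫_ℝ * ⟪b, z.2⟫_ℝ) +
        r * (⟪b, z.2⟫_ℝ * ⟪b, z.2⟫_ℝ)) +
      (4 * C * L ^ 2 + 8 * C * L ^ 3) * d ^ 3 * (c + (‖z.1‖ + ‖z.2‖)) ^ 3) := by
    intro z
    have hz1 := norm_nonneg z.1
    have hz2 := norm_nonneg z.2
    set G := c + (‖z.1‖ + ‖z.2‖) with hG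
    have hc0 : 0 ≤ c := by positivity
    have hG0 : 0 ≤ G := by positivity
    have hG1 : c + ‖z.1‖ ≤ G := by linarith
    have hG2 : c + ‖z.2‖ ≤ G := by linarith
    have t := hTay _ (hf.mem_Icc (x + d • z.1)) _ (hg.mem_Icc (y + d • z.2))
    obtain ⟨a1, a2⟩ := ha z.1
    obtain ⟨b1, b2⟩ := hb z.2
    replace a1 := a1.trans (mul_le_mul_of_nonneg_left hG1 (by positivity))
    replace b1 := b1.trans (mul_le_mul_of_nonneg_left hG2 (by positivity))
    replace a2 := a2.trans (mul_le_mul_of_nonneg_left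
      (pow_le_pow_left₀ (by positivity) hG1 2) (by positivity))
    replace b2 := b2.trans (mul_le_mul_of_nonneg_left
      (pow_le_pow_left₀ (by positivity) hG2 2) (by positivity))
    have hlin : ∀ (a z : E), ‖a‖ ≤ L → ‖z‖ ≤ G → |d * ⟪a, z⟫_ℝ| ≤ L * d * G := by
      intro a z haL hzG
      rw [abs_mul, abs_of_nonneg hd, mul_comm L, mul_assoc]
      refine mul_le_mul_of_nonneg_left ((abs_real_inner_le_norm a z).trans ?_) hd
      exact mul_le_mul haL hzG (norm_nonneg _) hL
    have hquad := quadratic_sub_le hp hq hr hd hG0 hL a1 b1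
      (hlin a z.1 haL (by linarith)) (hlin b z.2 hbL (by linarith)) a2 b2
    have hcub : C * (|f (x + d • z.1) - m| + |g (y + d • z.2) - n|) ^ 3 ≤
        C * (L * d * G + L * d * G) ^ 3 := by gcongr
    have e1 : C * (L * d * G + L * d * G) ^ 3 = 8 * C * L ^ 3 * d ^ 3 * G ^ 3 := by ring
    calc _ ≤ _ := t
      _ ≤ _ := by linarith
  have hcorr : ∀ a b : E,
      Integrable (fun z : E × E => ⟪a, z.1⟫_ℝ * ⟪b, z.2⟫_ℝ) (corrGaussian E ρ) :=
    integrable_inner_fst_mul_inner_snd_corrGaussian h₁ h₂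
  have hsq : ∀ a : E, Integrable (fun z : E => ⟪a, z⟫_ℝ * ⟪a, z⟫_ℝ) (stdGaussian E) := fun a =>
    (memLp_inner_stdGaussian a).integrable_mul (memLp_inner_stdGaussian a)
  have hsqm : ∀ a : E, Measurable (fun z : E => ⟪a, z⟫_ℝ * ⟪a, z⟫_ℝ) := fun a => by fun_prop
  have i1 := integrable_fst_corrGaussian (ρ := ρ) (hif.sub (integrable_const m))
  have i2 := integrable_snd_corrGaussian h₁ h₂ (hig.sub (integrable_const n))
  have i3 := integrable_fst_corrGaussian (ρ := ρ) (hsq a)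
  have i4 := hcorr a b
  have i5 := integrable_snd_corrGaussian h₁ h₂ (hsq b)
  have i6 := integrable_add_norm_pow_three_corrGaussian (E := E) ρ c
  have v1 : ∫ z : E × E, (f (x + d • z.1) - m) ∂(corrGaussian E ρ) = 0 := by
    rw [integral_fst_corrGaussian (f := fun z => f (x + d • z) - m) (hfm.sub_const m),
      integral_sub hif (integrable_const m)]
    simp [hm, heat, hdd]
  have v2 : ∫ z : E × E, (g (y + d • z.2) - n) ∂(corrGaussian E ρ) = 0 := by
    rw [integral_snd_corrGaussian h₁ h₂ (f := fun z => g (y + d • z) - n) (hgm.sub_const n),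
      integral_sub hig (integrable_const n)]
    simp [hn, heat, hdd]
  have v3 : ∫ z : E × E, ⟪a, z.1⟫_ℝ * ⟪a, z.1⟫_ℝ ∂(corrGaussian E ρ) = ‖a‖ ^ 2 := by
    rw [integral_fst_corrGaussian (hsqm a), integral_inner_mul_inner_stdGaussian,
      real_inner_self_eq_norm_sq]
  have v4 : ∫ z : E × E, ⟪a, z.1⟫_ℝ * ⟪b, z.2⟫_ℝ ∂(corrGaussian E ρ) = ρ * ⟪a, b⟫_ℝ :=
    integral_inner_fst_mul_inner_snd_corrGaussian a b
  have v5 : ∫ z : E × E, ⟪b, z.2⟫_ℝ * ⟪b, z.2⟫_ℝ ∂(corrGaussian E ρ) = ‖b‖ ^ 2 := by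
    rw [integral_snd_corrGaussian h₁ h₂ (hsqm b), integral_inner_mul_inner_stdGaussian,
      real_inner_self_eq_norm_sq]
  simp only [Pi.sub_apply] at i1 i2
  have j1 : Integrable (fun z : E × E => α * (f (x + d • z.1) - m) + β * (g (y + d • z.2) - n))
      (corrGaussian E ρ) := (i1.const_mul α).add (i2.const_mul β)
  have j2 : Integrable (fun z : E × E => K m n + (α * (f (x + d • z.1) - m) +
      β * (g (y + d • z.2) - n))) (corrGaussian E ρ) := (integrable_const _).add j1
  have j3 : Integrable (fun z : E × E => p * (⟪a, z.1⟫_ℝ * ⟪a, z.1⟫_ℝ) +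
      2 * q * (⟪a, z.1⟫_ℝ * ⟪b, z.2⟫_ℝ)) (corrGaussian E ρ) :=
    (i3.const_mul p).add (i4.const_mul (2 * q))
  have j4 : Integrable (fun z : E × E => p * (⟪a, z.1⟫_ℝ * ⟪a, z.1⟫_ℝ) +
      2 * q * (⟪a, z.1⟫_ℝ * ⟪b, z.2⟫_ℝ) + r * (⟪b, z.2⟫_ℝ * ⟪b, z.2⟫_ℝ)) (corrGaussian E ρ) :=
    j3.add (i5.const_mul r)
  have j5 : Integrable (fun z : E × E => d ^ 2 / 2 * (p * (⟪a, z.1⟫_ℝ * ⟪a, z.1⟫_ℝ) +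
      2 * q * (⟪a, z.1⟫_ℝ * ⟪b, z.2⟫_ℝ) + r * (⟪b, z.2⟫_ℝ * ⟪b, z.2⟫_ℝ)) +
      (4 * C * L ^ 2 + 8 * C * L ^ 3) * d ^ 3 * (c + (‖z.1‖ + ‖z.2‖)) ^ 3) (corrGaussian E ρ) :=
    (j4.const_mul (d ^ 2 / 2)).add (i6.const_mul ((4 * C * L ^ 2 + 8 * C * L ^ 3) * d ^ 3))
  have hKint : Integrable (fun z : E × E => K (f (x + d • z.1)) (g (y + d • z.2)))
      (corrGaussian E ρ) := by
    obtain ⟨B, hB⟩ := (isCompact_Icc.prod isCompact_Icc :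
      IsCompact (Set.Icc ε (1 - ε) ×ˢ Set.Icc ε (1 - ε))).exists_bound_of_continuousOn
        hK.continuousOn
    refine .of_bound (hK.measurable.comp ((hfm.comp measurable_fst).prodMk
      (hgm.comp measurable_snd))).aestronglyMeasurable B (.of_forall fun z => ?_)
    exact hB (f _, g _) ⟨hf.mem_Icc _, hg.mem_Icc _⟩
  calc _ ≤ _ := integral_mono hKint (j2.add j5) hpt
    _ = K m n + d ^ 2 / 2 * (p * ‖a‖ ^ 2 + 2 * ρ * q * ⟪a, b⟫_ℝ + r * ‖b‖ ^ 2) +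
        (4 * C * L ^ 2 + 8 * C * L ^ 3) * M * d ^ 3 := by
      rw [integral_add' j2 j5, integral_add (integrable_const _) j1,
        integral_add (i1.const_mul α) (i2.const_mul β), integral_const_mul, integral_const_mul,
        integral_add (j4.const_mul (d ^ 2 / 2)) (i6.const_mul _), integral_const_mul,
        integral_const_mul, integral_add j3 (i5.const_mul r),
        integral_add (i3.const_mul p) (i4.const_mul (2 * q)), integral_const_mul,
        integral_const_mul, integral_const_mul, v1, v2, v3, v4, v5, ← hM]
      simp
      ring
    _ ≤ _ := by
      have := mul_nonpos_of_nonneg_of_nonpos (by positivity : 0 ≤ d ^ 2 / 2)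
        (quadratic_inner_nonpos hform a b)
      linarith

end Increments

section FunctionalInequality

open scoped InnerProductSpace

variable {E : Type*} [NormedAddCommGroup E] [InnerProductSpace ℝ E]
  [MeasurableSpace E] [FiniteDimensional ℝ E] [BorelSpace E]

/-! ### Summing the increments -/

/-- The functional inequality for tame functions: `N` increments of variance `1 / N` together lose
`O(N^{-1/2})`. -/
theorem integral_le_of_isTame {K : ℝ → ℝ → ℝ} (hK : Continuous (Function.uncurry K)) {ρ : ℝ}
    (h₁ : -1 < ρ) (h₂ : ρ < 1) {ε L C : ℝ} (hε : 0 < ε)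
    (hT : HasConcaveTaylor K ρ (Set.Icc ε (1 - ε)) C) {f g : E → ℝ} (hf : IsTame ε L f)
    (hg : IsTame ε L g) :
    ∫ p, K (f p.1) (g p.2) ∂(corrGaussian E ρ) ≤
      K (∫ x, f x ∂(stdGaussian E)) (∫ x, g x ∂(stdGaussian E)) := by
  obtain ⟨A, hA⟩ := (isCompact_Icc.prod isCompact_Icc :
    IsCompact (Set.Icc ε (1 - ε) ×ˢ Set.Icc ε (1 - ε))).exists_bound_of_continuousOn hK.continuousOn
  have hbdd : ∀ {f g : E → ℝ}, IsTame ε L f → IsTame ε L g → ∀ p : E × E,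
      |K (f p.1) (g p.2)| ≤ A := fun hf hg p => hA (_, _) ⟨hf.mem_Icc _, hg.mem_Icc _⟩
  have hmeas : ∀ {f g : E → ℝ}, IsTame ε L f → IsTame ε L g →
      Measurable fun p : E × E => K (f p.1) (g p.2) := fun hf hg =>
    hK.measurable.comp ((hf.continuous.measurable.comp measurable_fst).prodMk
      (hg.continuous.measurable.comp measurable_snd))
  obtain ⟨B, hB⟩ := integral_increment_le (E := E) hK h₁ h₂ (L := L) hε hT
  have hstep : ∀ k : ℕ, ∀ f g : E → ℝ, IsTame ε L f → IsTame ε L g → ∀ δ : ℝ, 0 < δ →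
      ∀ p : E × E, heat (corrGaussian E ρ) (k * δ) (fun p => K (f p.1) (g p.2)) p ≤
        K (heat (stdGaussian E) (k * δ) f p.1) (heat (stdGaussian E) (k * δ) g p.2) +
          k * (B * Real.sqrt δ ^ 3) := by
    intro k
    induction k with
    | zero => intro f g hf hg δ hδ p; simp [heat]
    | succ k ih =>
      intro f g hf hg δ hδ p
      have hkδ : 0 ≤ (k : ℝ) * δ := by positivity
      have hf' := hf.heat (μ := stdGaussian E) hε δ
      have hg' := hg.heat (μ := stdGaussian E) hε δ
      have e : ((k + 1 : ℕ) : ℝ) * δ = k * δ + δ := by push_cast; ring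
      rw [e, ← heat_heat (integral_id_corrGaussian h₁ h₂) (hmeas hf hg) (hbdd hf hg) hkδ hδ,
        ← heat_heat integral_id_stdGaussian hf.continuous.measurable (hf.abs_le_one hε) hkδ hδ,
        ← heat_heat integral_id_stdGaussian hg.continuous.measurable (hg.abs_le_one hε) hkδ hδ]
      have i1 := integrable_comp_add_smul (μ := corrGaussian E ρ)
        (measurable_heat (μ := corrGaussian E ρ) (hmeas hf hg) δ)
        (abs_heat_le (hbdd hf hg) δ) p (Real.sqrt (k * δ))
      have i2 := integrable_comp_add_smul (μ := corrGaussian E ρ) (hmeas hf' hg')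
        (hbdd hf' hg') p (Real.sqrt (k * δ))
      calc heat (corrGaussian E ρ) (k * δ) (heat (corrGaussian E ρ) δ
            (fun p => K (f p.1) (g p.2))) p
          ≤ ∫ z, (K (heat (stdGaussian E) δ f (p + Real.sqrt (k * δ) • z).1)
              (heat (stdGaussian E) δ g (p + Real.sqrt (k * δ) • z).2) + B * Real.sqrt δ ^ 3)
                ∂(corrGaussian E ρ) :=
            integral_mono i1 (i2.add (integrable_const _)) fun z => hB f g hf hg δ _ _
        _ = heat (corrGaussian E ρ) (k * δ) (fun p => K (heat (stdGaussian E) δ f p.1)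
              (heat (stdGaussian E) δ g p.2)) p + B * Real.sqrt δ ^ 3 := by
            rw [integral_add i2 (integrable_const _)]
            simp [heat]
        _ ≤ _ := by
            have := ih _ _ hf' hg' δ hδ p
            push_cast
            linarith
  have hN : ∀ N : ℕ, ∫ p, K (f p.1) (g p.2) ∂(corrGaussian E ρ) ≤
      K (∫ x, f x ∂(stdGaussian E)) (∫ x, g x ∂(stdGaussian E)) +
        B * Real.sqrt (1 / ((N : ℝ) + 1)) := by
    intro N
    have hpos : 0 < (N : ℝ) + 1 := by positivity
    have h := hstep (N + 1) f g hf hg (1 / ((N : ℝ) + 1)) (by positivity) 0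
    have e1 : ((N + 1 : ℕ) : ℝ) * (1 / ((N : ℝ) + 1)) = 1 := by
      push_cast
      field_simp
    have e2 : ((N + 1 : ℕ) : ℝ) * (B * Real.sqrt (1 / ((N : ℝ) + 1)) ^ 3) =
        B * Real.sqrt (1 / ((N : ℝ) + 1)) := by
      rw [pow_succ, Real.sq_sqrt (by positivity)]
      push_cast
      field_simp
    rw [e1, e2] at h
    simpa [heat] using h
  have hlim : Tendsto (fun N : ℕ => K (∫ x, f x ∂(stdGaussian E)) (∫ x, g x ∂(stdGaussian E)) +
      B * Real.sqrt (1 / ((N : ℝ) + 1))) atTop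
      (𝓝 (K (∫ x, f x ∂(stdGaussian E)) (∫ x, g x ∂(stdGaussian E)))) := by
    have h0 : Tendsto (fun N : ℕ => Real.sqrt (1 / ((N : ℝ) + 1))) atTop (𝓝 0) := by
      have := (Real.continuous_sqrt.tendsto 0).comp
        (tendsto_one_div_add_atTop_nhds_zero_nat (𝕜 := ℝ))
      rwa [Real.sqrt_zero] at this
    simpa using (h0.const_mul B).const_add _
  exact ge_of_tendsto' hlim hN

/-! ### Approximation by tame functions -/

theorem exists_quadratic_bound {F : Type*} [NormedAddCommGroup F] [NormedSpace ℝ F] {k : F → ℝ}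
    (hk : ContDiff ℝ 2 k) (hs : HasCompactSupport k) :
    ∃ L : ℝ, ∀ x, ‖fderiv ℝ k x‖ ≤ L ∧ ∀ v, |k (x + v) - k x| ≤ L * ‖v‖ ∧
      |k (x + v) - k x - fderiv ℝ k x v| ≤ L * ‖v‖ ^ 2 := by
  obtain ⟨C₁, hC₁⟩ := hk.lipschitzWith_of_hasCompactSupport hs (by simp)
  have hk' : ContDiff ℝ 1 (fderiv ℝ k) := hk.fderiv_right (by norm_num)
  obtain ⟨C₂, hC₂⟩ := hk'.lipschitzWith_of_hasCompactSupport (hs.fderiv ℝ) (by simp)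
  refine ⟨C₁ + C₂, fun x => ⟨?_, fun v => ⟨?_, ?_⟩⟩⟩
  · exact (norm_fderiv_le_of_lipschitz ℝ hC₁).trans (le_add_of_nonneg_right C₂.2)
  · have := hC₁.dist_le_mul (x + v) x
    rw [Real.dist_eq, dist_eq_norm, add_sub_cancel_left] at this
    exact this.trans (mul_le_mul_of_nonneg_right (le_add_of_nonneg_right C₂.2) (norm_nonneg _))
  · have hseg : ∀ y ∈ segment ℝ x (x + v), ‖fderiv ℝ k y - fderiv ℝ k x‖ ≤ C₂ * ‖v‖ := by
      intro y hy
      have := hC₂.dist_le_mul y x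
      rw [dist_eq_norm, dist_eq_norm] at this
      refine this.trans (mul_le_mul_of_nonneg_left ?_ C₂.2)
      have := norm_sub_le_of_mem_segment hy
      simpa using this
    have := (convex_segment x (x + v)).norm_image_sub_le_of_norm_hasFDerivWithin_le'
      (fun y _ => ((hk.differentiable (by simp)) y).hasFDerivAt.hasFDerivWithinAt) hseg
      (left_mem_segment ℝ x (x + v)) (right_mem_segment ℝ x (x + v))
    rw [add_sub_cancel_left, Real.norm_eq_abs, mul_assoc, ← sq] at this
    exact this.trans (mul_le_mul_of_nonneg_right (le_add_of_nonneg_left C₁.2) (by positivity))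

/-- Tame functions are `L¹`-dense among the measurable functions with values in `[0, 1]`. -/
theorem exists_isTame_approx {f : E → ℝ} (hf : Measurable f)
    (hf01 : ∀ x, f x ∈ Set.Icc (0 : ℝ) 1) {η : ℝ} (hη : 0 < η) :
    ∃ ε L : ℝ, 0 < ε ∧ ∃ h : E → ℝ, IsTame ε L h ∧ ∫ x, |f x - h x| ∂(stdGaussian E) ≤ η := by
  set κ := min (η / 6) (1 / 8) with hκ
  have hκ0 : 0 < κ := by positivity
  have hκη : 6 * κ ≤ η := by linarith [min_le_left (η / 6) (1 / 8)]
  have hκ8 : κ ≤ 1 / 8 := min_le_right _ _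
  have hfi : Integrable f (stdGaussian E) :=
    .of_bound hf.aestronglyMeasurable 1 (.of_forall fun x => by
      rw [Real.norm_of_nonneg (hf01 x).1]
      exact (hf01 x).2)
  obtain ⟨g, hgs, hgκ, hgc, hgi⟩ := hfi.exists_hasCompactSupport_integral_sub_le hκ0
  have hgc' : Continuous fun x => max 0 (min (g x) 1) := by fun_prop
  obtain ⟨k, hk, hkκ, hks⟩ := hgc'.exists_contDiff_approx 2 (ε := fun _ => κ) continuous_const
    fun _ => hκ0
  have hkc : HasCompactSupport k := hgs.mono (hks.trans fun x hx h0 => hx (by simp [h0]))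
  obtain ⟨L, hL⟩ := exists_quadratic_bound (k := k) (by exact_mod_cast hk) hkc
  set s := 1 - 4 * κ with hs
  have hs0 : 0 ≤ s := by linarith
  have hs1 : s ≤ 1 := by linarith
  have hkb : ∀ x, -κ ≤ k x ∧ k x ≤ 1 + κ := fun x => by
    obtain ⟨h1, h2⟩ := abs_lt.1 (hkκ x)
    have h3 : 0 ≤ max 0 (min (g x) 1) := le_max_left _ _
    have h4 : max 0 (min (g x) 1) ≤ 1 := max_le zero_le_one (min_le_right _ _)
    exact ⟨by linarith, by linarith⟩
  have hsc : ∀ {t B : ℝ}, |t| ≤ B → |s * t| ≤ B := fun {t B} ht => by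
    rw [abs_mul, abs_of_nonneg hs0]
    exact (mul_le_of_le_one_left (abs_nonneg _) hs1).trans ht
  have htame : IsTame κ L fun x => 1 / 2 + s * (k x - 1 / 2) := by
    refine ⟨fun x => ?_, fun x v => ?_,
      fun x => s • (InnerProductSpace.toDual ℝ E).symm (fderiv ℝ k x), ?_, fun x => ?_,
      fun x v => ?_⟩
    · -- The factor `s` is chosen so that `s (1/2 + κ) ≤ 1/2 - κ`.
      obtain ⟨h1, h2⟩ := hkb x
      constructor <;> nlinarith
    · rw [show 1 / 2 + s * (k (x + v) - 1 / 2) - (1 / 2 + s * (k x - 1 / 2)) =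
        s * (k (x + v) - k x) by ring]
      exact hsc ((hL x).2 v).1
    · have : Continuous (fderiv ℝ k) := hk.continuous_fderiv (by simp)
      exact (((InnerProductSpace.toDual ℝ E).symm.continuous.comp this).const_smul s).measurable
    · rw [norm_smul, LinearIsometryEquiv.norm_map, Real.norm_of_nonneg hs0]
      exact (mul_le_of_le_one_left (norm_nonneg _) hs1).trans (hL x).1
    · rw [real_inner_smul_left, InnerProductSpace.toDual_symm_apply,
        show 1 / 2 + s * (k (x + v) - 1 / 2) - (1 / 2 + s * (k x - 1 / 2)) -
          s * fderiv ℝ k x v = s * (k (x + v) - k x - fderiv ℝ k x v) by ring]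
      exact hsc ((hL x).2 v).2
  refine ⟨κ, L, hκ0, _, htame, ?_⟩
  have hpt : ∀ x, |f x - (1 / 2 + s * (k x - 1 / 2))| ≤ ‖f x - g x‖ + 5 * κ := fun x => by
    obtain ⟨h1, h2⟩ := hkb x
    have t1 : |f x - max 0 (min (g x) 1)| ≤ ‖f x - g x‖ := by
      have := abs_max_sub_max_le_abs (f x) (min (g x) 1) 0
      have h' := abs_min_sub_min_le_max (f x) 1 (g x) 1
      obtain ⟨h3, h4⟩ := hf01 x
      rw [min_eq_left h4] at h'
      rw [max_eq_left h3, max_comm] at this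
      refine this.trans (h'.trans ?_)
      simp
    have t2 := abs_le.1 (hkκ x).le
    have t3 := abs_le.1 t1
    refine abs_le.2 ⟨?_, ?_⟩ <;> nlinarith
  have hi : Integrable (fun x => ‖f x - g x‖) (stdGaussian E) := (hfi.sub hgi).norm
  calc ∫ x, |f x - (1 / 2 + s * (k x - 1 / 2))| ∂(stdGaussian E)
      ≤ ∫ x, (‖f x - g x‖ + 5 * κ) ∂(stdGaussian E) :=
        integral_mono_of_nonneg (.of_forall fun x => abs_nonneg _)
          (hi.add (integrable_const _)) (.of_forall hpt)
    _ = ∫ x, ‖f x - g x‖ ∂(stdGaussian E) + 5 * κ := by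
        rw [integral_add hi (integrable_const _)]
        simp
    _ ≤ η := by linarith

/-! ### From tame to measurable functions -/

/-- Both sides of the inequality are Lipschitz in `f` and `g` for the `L¹` distance, so it extends
from tame functions to measurable ones, including those that take the values `0` and `1`. -/
theorem integrable_and_integral_le {K : ℝ → ℝ → ℝ} {ρ : ℝ} (h₁ : -1 < ρ) (h₂ : ρ < 1)
    (hLip : ∀ x y x' y', |K x y - K x' y'| ≤ |x - x'| + |y - y'|)
    (hT : ∀ ε : ℝ, 0 < ε → ∃ C, HasConcaveTaylor K ρ (Set.Icc ε (1 - ε)) C)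
    {f g : E → ℝ} (hf : Measurable f) (hg : Measurable g)
    (hf01 : ∀ x, f x ∈ Set.Icc (0 : ℝ) 1) (hg01 : ∀ x, g x ∈ Set.Icc (0 : ℝ) 1) :
    Integrable (fun p => K (f p.1) (g p.2)) (corrGaussian E ρ) ∧
      ∫ p, K (f p.1) (g p.2) ∂(corrGaussian E ρ) ≤
        K (∫ x, f x ∂(stdGaussian E)) (∫ x, g x ∂(stdGaussian E)) := by
  have hK : Continuous (Function.uncurry K) := by
    have : LipschitzWith 2 (Function.uncurry K) := LipschitzWith.of_dist_le_mul fun p q => by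
      have h := hLip p.1 p.2 q.1 q.2
      have h1 : |p.1 - q.1| ≤ dist p q := le_max_left _ _
      have h2 : |p.2 - q.2| ≤ dist p q := le_max_right _ _
      rw [Real.dist_eq]
      simp only [Function.uncurry, NNReal.coe_ofNat]
      linarith
    exact this.continuous
  obtain ⟨A, hA⟩ := (isCompact_Icc.prod isCompact_Icc :
    IsCompact (Set.Icc (0 : ℝ) 1 ×ˢ Set.Icc (0 : ℝ) 1)).exists_bound_of_continuousOn hK.continuousOn
  have hint : ∀ {f g : E → ℝ}, Measurable f → Measurable g → (∀ x, f x ∈ Set.Icc (0 : ℝ) 1) →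
      (∀ x, g x ∈ Set.Icc (0 : ℝ) 1) →
      Integrable (fun p => K (f p.1) (g p.2)) (corrGaussian E ρ) := fun hf hg hf01 hg01 =>
    .of_bound (hK.measurable.comp ((hf.comp measurable_fst).prodMk
      (hg.comp measurable_snd))).aestronglyMeasurable A
      (.of_forall fun p => hA (_, _) ⟨hf01 _, hg01 _⟩)
  have hint1 : ∀ {f : E → ℝ}, Measurable f → (∀ x, f x ∈ Set.Icc (0 : ℝ) 1) →
      Integrable f (stdGaussian E) := fun hf hf01 =>
    .of_bound hf.aestronglyMeasurable 1 (.of_forall fun x => by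
      rw [Real.norm_of_nonneg (hf01 x).1]
      exact (hf01 x).2)
  refine ⟨hint hf hg hf01 hg01, le_of_forall_pos_le_add fun η hη => ?_⟩
  obtain ⟨ε₁, L₁, hε₁, f', hf', hff'⟩ := exists_isTame_approx hf hf01 (by positivity : 0 < η / 4)
  obtain ⟨ε₂, L₂, hε₂, g', hg', hgg'⟩ := exists_isTame_approx hg hg01 (by positivity : 0 < η / 4)
  have hε : 0 < min ε₁ ε₂ := lt_min hε₁ hε₂
  replace hf' := hf'.mono (min_le_left ε₁ ε₂) (le_max_left L₁ L₂)
  replace hg' := hg'.mono (min_le_right ε₁ ε₂) (le_max_right L₁ L₂)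
  obtain ⟨C, hC⟩ := hT _ hε
  have main := integral_le_of_isTame hK h₁ h₂ hε hC hf' hg'
  have h01 : Set.Icc (min ε₁ ε₂) (1 - min ε₁ ε₂) ⊆ Set.Icc 0 1 :=
    Set.Icc_subset_Icc hε.le (by linarith)
  have hf'm := hf'.continuous.measurable
  have hg'm := hg'.continuous.measurable
  have hf'i := hint1 hf'm fun x => h01 (hf'.mem_Icc x)
  have hg'i := hint1 hg'm fun x => h01 (hg'.mem_Icc x)
  have hfi := hint1 hf hf01
  have hgi := hint1 hg hg01
  have i1 := hint hf hg hf01 hg01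
  have i2 := hint hf'm hg'm (fun x => h01 (hf'.mem_Icc x)) fun x => h01 (hg'.mem_Icc x)
  have df : Integrable (fun x => |f x - f' x|) (stdGaussian E) := (hfi.sub hf'i).abs
  have dg : Integrable (fun x => |g x - g' x|) (stdGaussian E) := (hgi.sub hg'i).abs
  have d1 := integrable_fst_corrGaussian (ρ := ρ) df
  have d2 := integrable_snd_corrGaussian h₁ h₂ dg
  have left : ∫ p, K (f p.1) (g p.2) ∂(corrGaussian E ρ) ≤
      ∫ p, K (f' p.1) (g' p.2) ∂(corrGaussian E ρ) + (η / 4 + η / 4) := by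
    calc ∫ p, K (f p.1) (g p.2) ∂(corrGaussian E ρ)
        ≤ ∫ p, (K (f' p.1) (g' p.2) + (|f p.1 - f' p.1| + |g p.2 - g' p.2|))
            ∂(corrGaussian E ρ) :=
          integral_mono i1 (i2.add (d1.add d2)) fun p => by
            have := (abs_le.1 (hLip (f p.1) (g p.2) (f' p.1) (g' p.2))).2
            linarith
      _ = ∫ p, K (f' p.1) (g' p.2) ∂(corrGaussian E ρ) +
            (∫ x, |f x - f' x| ∂(stdGaussian E) + ∫ x, |g x - g' x| ∂(stdGaussian E)) := by
          have d12 : Integrable (fun p : E × E => |f p.1 - f' p.1| + |g p.2 - g' p.2|)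
              (corrGaussian E ρ) := d1.add d2
          rw [integral_add i2 d12, integral_add d1 d2,
            integral_fst_corrGaussian (f := fun x => |f x - f' x|) (by fun_prop),
            integral_snd_corrGaussian h₁ h₂ (f := fun x => |g x - g' x|) (by fun_prop)]
      _ ≤ _ := by gcongr
  have hmean : ∀ {f f' : E → ℝ}, Integrable f (stdGaussian E) → Integrable f' (stdGaussian E) →
      ∫ x, |f x - f' x| ∂(stdGaussian E) ≤ η / 4 →
      |∫ x, f' x ∂(stdGaussian E) - ∫ x, f x ∂(stdGaussian E)| ≤ η / 4 := fun hf hf' h => by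
    rw [abs_sub_comm, ← integral_sub hf hf']
    exact (abs_integral_le_integral_abs).trans h
  have right := (abs_le.1 (hLip (∫ x, f' x ∂(stdGaussian E)) (∫ x, g' x ∂(stdGaussian E))
    (∫ x, f x ∂(stdGaussian E)) (∫ x, g x ∂(stdGaussian E)))).2
  have m1 := hmean hfi hf'i hff'
  have m2 := hmean hgi hg'i hgg'
  linarith

end FunctionalInequality

/-! ### Signs of the correlation -/

theorem hasConcaveTaylor_borellJ {ρ : ℝ} (h₀ : 0 < ρ) (h₂ : ρ < 1) {ε : ℝ} (hε : 0 < ε) :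
    ∃ C, HasConcaveTaylor (fun x y => borellJ x y ρ) ρ (Set.Icc ε (1 - ε)) C := by
  obtain ⟨C, hC⟩ := exists_borellJ_taylor (by linarith : -1 < ρ) h₂ hε
  refine ⟨C, fun x hx y hy => ?_⟩
  obtain ⟨α, β, p, q, r, hp, hq, hr, ⟨k, hk, c, d, hform⟩, hT⟩ := hC x hx y hy
  refine ⟨α, β, p, q, r, hp, hq, hr, fun a b => ?_, fun x' hx' y' hy' => ?_⟩
  · rw [hform, neg_mul, neg_mul, neg_nonpos]
    positivity
  · have := (abs_le.1 (hT x' hx' y' hy')).2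
    linarith

theorem hasConcaveTaylor_neg_borellJ {ρ : ℝ} (h₁ : -1 < ρ) (h₀ : ρ < 0) {ε : ℝ} (hε : 0 < ε) :
    ∃ C, HasConcaveTaylor (fun x y => -borellJ x y ρ) ρ (Set.Icc ε (1 - ε)) C := by
  obtain ⟨C, hC⟩ := exists_borellJ_taylor h₁ (by linarith : ρ < 1) hε
  refine ⟨C, fun x hx y hy => ?_⟩
  obtain ⟨α, β, p, q, r, hp, hq, hr, ⟨k, hk, c, d, hform⟩, hT⟩ := hC x hx y hy
  refine ⟨-α, -β, -p, -q, -r, by rwa [abs_neg], by rwa [abs_neg], by rwa [abs_neg],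
    fun a b => ?_, fun x' hx' y' hy' => ?_⟩
  · have h := hform a b
    have : 0 ≤ -ρ * k * (c * a - d * b) ^ 2 :=
      mul_nonneg (mul_nonneg (by linarith) hk) (sq_nonneg _)
    linarith
  · have := (abs_le.1 (hT x' hx' y' hy')).1
    linarith

theorem theorem2 (n : ℕ) (f g : EuclideanSpace ℝ (Fin n) → ℝ)
    (hf : Measurable f) (hg : Measurable g)
    (hf01 : ∀ x, f x ∈ Set.Icc (0 : ℝ) 1) (hg01 : ∀ x, g x ∈ Set.Icc (0 : ℝ) 1) (ρ : ℝ) :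
    (0 < ρ → ρ < 1 →
      Integrable (fun p => borellJ (f p.1) (g p.2) ρ)
          (corrGaussian (EuclideanSpace ℝ (Fin n)) ρ) ∧
        ∫ p, borellJ (f p.1) (g p.2) ρ ∂(corrGaussian (EuclideanSpace ℝ (Fin n)) ρ) ≤
          borellJ (∫ x, f x ∂(stdGaussian (EuclideanSpace ℝ (Fin n))))
            (∫ x, g x ∂(stdGaussian (EuclideanSpace ℝ (Fin n)))) ρ) ∧
    (-1 < ρ → ρ < 0 →
      Integrable (fun p => borellJ (f p.1) (g p.2) ρ)
          (corrGaussian (EuclideanSpace ℝ (Fin n)) ρ) ∧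
        borellJ (∫ x, f x ∂(stdGaussian (EuclideanSpace ℝ (Fin n))))
            (∫ x, g x ∂(stdGaussian (EuclideanSpace ℝ (Fin n)))) ρ ≤
          ∫ p, borellJ (f p.1) (g p.2) ρ ∂(corrGaussian (EuclideanSpace ℝ (Fin n)) ρ)) := by
  refine ⟨fun h₀ h₂ => ?_, fun h₁ h₀ => ?_⟩
  · have h₁ : -1 < ρ := by linarith
    exact integrable_and_integral_le h₁ h₂ (abs_borellJ_sub_le h₁ h₂)
      (fun ε hε => hasConcaveTaylor_borellJ h₀ h₂ hε) hf hg hf01 hg01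
  · have h₂ : ρ < 1 := by linarith
    obtain ⟨hi, hle⟩ := integrable_and_integral_le (K := fun x y => -borellJ x y ρ) h₁ h₂
      (fun x y x' y' => by
        rw [neg_sub_neg, abs_sub_comm]
        exact abs_borellJ_sub_le h₁ h₂ x y x' y')
      (fun ε hε => hasConcaveTaylor_neg_borellJ h₁ h₀ hε) hf hg hf01 hg01
    rw [integral_neg] at hle
    exact ⟨by simpa using hi.neg, neg_le_neg_iff.1 hle⟩
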